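/- Let $k$ be an algebraically closed field of characteristic zero, let $G$ be a finite group, and let $\mathcal C$ be a fusion category over $k$ which is a $G$-extension of $\mathrm{Vec}_{\mathbb Z_2}^{\omega}$; that is, $\mathcal C$ has a faithful grading $\mathcal C=\bigoplus_{g\in G}\mathcal C_g$ (so $\mathcal C_g\otimes\mathcal C_h\subseteq\mathcal C_{gh}$ and $\mathcal C_g\neq 0$ for all $g,h\in G$) whose trivial component $\mathcal C_e$ is equivalent, as a fusion category, to the category $\mathrm{Vec}_{\mathbb Z_2}^{\omega}$ of finite-dimensional $\mathbb Z_2$-graded vector spaces with associator given by a normalized 3-cocycle $\omega:\mathbb Z_2^3\to k^\times$. A simple object $X$ is invertible if $X\otimes X^*\cong\mathbf 1$, and a fusion category is pointed if all its simple objects are invertible. A fusion category is generalized Tambara–Yamagami if it is not pointed and the tensor product of any two non-invertible simple objects is a direct sum of invertible objects. Then: (1) If the class of $\omega$ in $H^3(\mathbb Z_2,k^\times)$ is nontrivial, then $\mathcal C$ is pointed. (2) If the class of $\omega$ is trivial, then $\mathcal C$ is either pointed or a generalized Tambara–Yamagami fusion category. If $\mathcal C$ is generalized Tambara–Yamagami,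 then there is an integer $n\ge 1$ such that: (i) up to isomorphism, $\mathcal C$ has exactly $2n$ invertible objects and exactly $n$ simple objects of Frobenius–Perron dimension $\sqrt2$, and these are all its simple objects; (ii) the adjoint subcategory $\mathcal C_{ad}$ (the fusion subcategory generated by the simple constituents of $X\otimes X^*$ for all simple objects $X$) is equivalent to $\mathrm{Vec}_{\mathbb Z_2}$ as a fusion category, and the universal grading group $U(\mathcal C)$ is $G$, of order $2n$; more precisely, the given $G$-grading is the universal grading of $\mathcal C$, so that $\mathcal C_e=\mathcal C_{ad}$. -/

import Mathlib

open CategoryTheory CategoryTheory.Limits MonoidalCategory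
open scoped TensorProduct

namespace Fusion

universe w v u

/-! ### Normalized 3-cocycles -/

/-- A normalized 3-cocycle on a group `G` with values in `kˣ` (trivial action). -/
structure Cocycle3 (G : Type*) [Group G] (k : Type*) [Field k] where
  toFun : G → G → G → kˣ
  cocycle : ∀ a b c d : G,
    toFun a b c * toFun a (b * c) d * toFun b c d = toFun (a * b) c d * toFun a b (c * d)
  one_left : ∀ a b : G, toFun 1 a b = 1
  one_mid : ∀ a b : G, toFun a 1 b = 1
  one_right : ∀ a b : G, toFun a b 1 = 1

namespace Cocycle3

variable (G : Type*) [Group G] (k : Type*) [Field k]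

/-- The constant cocycle with value `1`. -/
def trivial : Cocycle3 G k where
  toFun _ _ _ := 1
  cocycle := by simp
  one_left := by simp
  one_mid := by simp
  one_right := by simp

variable {G k}

/-- `ω` is cohomologically trivial: it is the coboundary `du` of a 2-cochain `u`. -/
def IsCoboundary (ω : Cocycle3 G k) : Prop :=
  ∃ u : G → G → kˣ, ∀ a b c : G,
    ω.toFun a b c = u b c * (u (a * b) c)⁻¹ * u a (b * c) * (u a b)⁻¹

end Cocycle3

/-! ### The pointed fusion category `Vec_G^ω` -/

/-- Objects of `Vec_G^ω`: finite-dimensional `k`-vector spaces `V = ⨁_{g ∈ G} V_g`. -/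
structure VecG (k : Type u) [Field k] {G : Type w} [Group G] (ω : Cocycle3 G k) where
  carrier : Type u
  [addCommGroup : AddCommGroup carrier]
  [module : Module k carrier]
  [finite : Module.Finite k carrier]
  grading : G → Submodule k carrier
  independent : iSupIndep grading
  iSup_eq_top : ⨆ g, grading g = ⊤

namespace VecG

attribute [instance] addCommGroup module finite

variable {k : Type u} [Field k] {G : Type w} [Group G] {ω : Cocycle3 G k}

/-- Morphisms of `Vec_G^ω`: linear maps which preserve degrees. -/
def homs (V W : VecG k ω) : Submodule k (V.carrier →ₗ[k] W.carrier) where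
  carrier := {f | ∀ g, ∀ x ∈ V.grading g, f x ∈ W.grading g}
  zero_mem' := fun g _ _ => (W.grading g).zero_mem
  add_mem' := fun hf hf' g x hx => (W.grading g).add_mem (hf g x hx) (hf' g x hx)
  smul_mem' := fun c _ hf g x hx => (W.grading g).smul_mem c (hf g x hx)

instance : Category (VecG k ω) where
  Hom V W := homs V W
  id V := ⟨LinearMap.id, fun _ _ hx => hx⟩
  comp f f' := ⟨f'.1 ∘ₗ f.1, fun g x hx => f'.2 g _ (f.2 g x hx)⟩

/-- The underlying linear map of a morphism. -/
def lin {V W : VecG k ω} (f : V ⟶ W) : V.carrier →ₗ[k] W.carrier := Subtype.val f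

/-- A morphism from a degree-preserving linear map. -/
def mkHom {V W : VecG k ω} (f : V.carrier →ₗ[k] W.carrier)
    (hf : ∀ g, ∀ x ∈ V.grading g, f x ∈ W.grading g) : V ⟶ W := ⟨f, hf⟩

lemma hom_ext {V W : VecG k ω} {f f' : V ⟶ W} (h : lin f = lin f') : f = f' := Subtype.ext h

@[simp] lemma lin_mkHom {V W : VecG k ω} (f : V.carrier →ₗ[k] W.carrier)
    (hf : ∀ g, ∀ x ∈ V.grading g, f x ∈ W.grading g) : lin (mkHom f hf) = f := rfl

@[simp] lemma lin_id (V : VecG k ω) : lin (𝟙 V) = LinearMap.id := rfl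

@[simp] lemma lin_comp {V W U : VecG k ω} (f : V ⟶ W) (f' : W ⟶ U) :
    lin (f ≫ f') = lin f' ∘ₗ lin f := rfl

lemma lin_mem {V W : VecG k ω} (f : V ⟶ W) {g : G} {x : V.carrier} (hx : x ∈ V.grading g) :
    lin f x ∈ W.grading g := f.2 g x hx

instance : Preadditive (VecG k ω) where
  homGroup V W := inferInstanceAs (AddCommGroup (homs V W))
  add_comp _ _ _ f f' h := hom_ext (LinearMap.comp_add (lin f) (lin f') (lin h))
  comp_add _ _ _ f h h' := hom_ext (LinearMap.add_comp (lin f) (lin h') (lin h))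

instance : Linear k (VecG k ω) where
  homModule V W := inferInstanceAs (Module k (homs V W))
  smul_comp _ _ _ r f h := hom_ext (LinearMap.ext fun x => (lin h).map_smul r (lin f x))
  comp_smul _ _ _ _ _ _ := hom_ext (LinearMap.ext fun _ => rfl)

lemma isCompl_grading (V : VecG k ω) (a : G) :
    IsCompl (V.grading a) (⨆ (b) (_ : b ≠ a), V.grading b) := by
  refine ⟨V.independent a, ?_⟩
  rw [codisjoint_iff, ← V.iSup_eq_top]
  apply le_antisymm
  · exact sup_le (le_iSup _ a) (iSup₂_le fun b _ => le_iSup _ b)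
  · refine iSup_le fun b => ?_
    by_cases h : b = a
    · subst h; exact le_sup_left
    · exact le_sup_of_le_right (le_iSup₂_of_le b h le_rfl)

/-- The projection of `V` onto its component of degree `a`. -/
noncomputable def proj (V : VecG k ω) (a : G) : V.carrier →ₗ[k] V.carrier :=
  Submodule.projection _ _ (V.isCompl_grading a)

lemma proj_self (V : VecG k ω) {a : G} {x : V.carrier} (hx : x ∈ V.grading a) :
    V.proj a x = x :=
  Submodule.projection_apply_left (V.isCompl_grading a) ⟨x, hx⟩

lemma proj_ne (V : VecG k ω) {a b : G} (h : b ≠ a) {x : V.carrier} (hx : x ∈ V.grading b) :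
    V.proj a x = 0 := by
  unfold proj
  rw [Submodule.projection_apply_eq_zero_iff]
  exact (le_iSup₂_of_le (f := fun (b) (_ : b ≠ a) => V.grading b) b h le_rfl) hx

lemma induction (V : VecG k ω) {p : V.carrier → Prop} (x : V.carrier)
    (hom : ∀ g, ∀ y ∈ V.grading g, p y) (zero : p 0) (add : ∀ y z, p y → p z → p (y + z)) :
    p x :=
  Submodule.iSup_induction V.grading (motive := p) (V.iSup_eq_top ▸ Submodule.mem_top : x ∈ ⨆ g, V.grading g)
    hom zero add

lemma lin_ext {V : VecG k ω} {M : Type*} [AddCommGroup M] [Module k M]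
    {f f' : V.carrier →ₗ[k] M} (h : ∀ g, ∀ x ∈ V.grading g, f x = f' x) : f = f' :=
  LinearMap.ext fun x => V.induction (p := fun x => f x = f' x) x h (by simp)
    (fun y z hy hz => by simp [hy, hz])

/-- Independence of a family of submodules, from maps which are the identity on one member
and zero on the others. -/
lemma iSupIndep_of_proj {ι M : Type*} [AddCommGroup M] [Module k M] (A : ι → Submodule k M)
    (P : ι → M →ₗ[k] M) (h₁ : ∀ g, ∀ x ∈ A g, P g x = x)
    (h₂ : ∀ g h, h ≠ g → ∀ x ∈ A h, P g x = 0) : iSupIndep A := by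
  intro g
  rw [Submodule.disjoint_def]
  intro x hx hx'
  have hle : (⨆ (j) (_ : j ≠ g), A j) ≤ LinearMap.ker (P g) :=
    iSup₂_le fun j hj y hy => h₂ g j hj y hy
  rw [← h₁ g x hx]
  exact hle hx'

/-- The degree `g` component of `V ⊗ W` is spanned by the `x ⊗ y` with `x` of degree `a`,
`y` of degree `b`, and `a * b = g`. -/
def tensorGrading (V W : VecG k ω) (g : G) : Submodule k (V.carrier ⊗[k] W.carrier) :=
  Submodule.span k {t | ∃ a b : G, a * b = g ∧ ∃ x ∈ V.grading a, ∃ y ∈ W.grading b, x ⊗ₜ[k] y = t}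

lemma tmul_mem (V W : VecG k ω) {a b : G} {x : V.carrier} {y : W.carrier}
    (hx : x ∈ V.grading a) (hy : y ∈ W.grading b) :
    x ⊗ₜ[k] y ∈ tensorGrading V W (a * b) :=
  Submodule.subset_span ⟨a, b, rfl, x, hx, y, hy, rfl⟩

lemma tensorGrading_le {V W : VecG k ω} {g : G} {S : Submodule k (V.carrier ⊗[k] W.carrier)}
    (h : ∀ a b : G, a * b = g → ∀ x ∈ V.grading a, ∀ y ∈ W.grading b, x ⊗ₜ[k] y ∈ S) :
    tensorGrading V W g ≤ S := by
  refine Submodule.span_le.2 ?_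
  rintro _ ⟨a, b, hab, x, hx, y, hy, rfl⟩
  exact h a b hab x hx y hy

lemma tensorGrading_independent [Fintype G] (V W : VecG k ω) : iSupIndep (tensorGrading V W) := by
  classical
  let P : G → V.carrier ⊗[k] W.carrier →ₗ[k] V.carrier ⊗[k] W.carrier := fun g =>
    ∑ c : G, TensorProduct.map (V.proj c) (W.proj (c⁻¹ * g))
  have key : ∀ g a b x y, x ∈ V.grading a → y ∈ W.grading b →
      P g (x ⊗ₜ y) = if a * b = g then x ⊗ₜ y else 0 := by
    intro g a b x y hx hy
    simp only [P, LinearMap.sum_apply, TensorProduct.map_tmul]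
    rw [Finset.sum_eq_single a]
    · rw [proj_self V hx]
      split_ifs with h
      · subst h; rw [inv_mul_cancel_left, proj_self W hy]
      · rw [proj_ne W _ hy, TensorProduct.tmul_zero]
        rintro rfl; exact h (mul_inv_cancel_left _ _)
    · intro c _ hc
      rw [proj_ne V (Ne.symm hc) hx, TensorProduct.zero_tmul]
    · simp
  refine iSupIndep_of_proj _ P (fun g x hx => ?_) (fun g h hne x hx => ?_)
  · have : tensorGrading V W g ≤ LinearMap.eqLocus (P g) LinearMap.id :=
      tensorGrading_le fun a b hab x hx y hy => by
        simp [LinearMap.mem_eqLocus, key g a b x y hx hy, hab]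
    exact this hx
  · have : tensorGrading V W h ≤ LinearMap.ker (P g) :=
      tensorGrading_le fun a b hab x hx y hy => by
        rw [LinearMap.mem_ker, key g a b x y hx hy, if_neg (hab ▸ hne)]
    exact this hx

lemma tensorGrading_iSup (V W : VecG k ω) : ⨆ g, tensorGrading V W g = ⊤ := by
  rw [eq_top_iff, ← TensorProduct.span_tmul_eq_top, Submodule.span_le]
  rintro _ ⟨x, y, rfl⟩
  refine V.induction (p := fun x => x ⊗ₜ[k] y ∈ ⨆ g, tensorGrading V W g) x ?_ (by simp) ?_
  · intro a x hx
    refine W.induction (p := fun y => x ⊗ₜ[k] y ∈ ⨆ g, tensorGrading V W g) y ?_ (by simp) ?_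
    · intro b y hy
      exact Submodule.mem_iSup_of_mem (a * b) (tmul_mem V W hx hy)
    · intro y z hy hz
      rw [TensorProduct.tmul_add]; exact Submodule.add_mem _ hy hz
  · intro x z hx hz
    rw [TensorProduct.add_tmul]; exact Submodule.add_mem _ hx hz

/-- The unit object: the line `k` in degree `1`. -/
def unit (ω : Cocycle3 G k) : VecG k ω where
  carrier := k
  grading g :=
    { carrier := {x | g ≠ 1 → x = 0}
      zero_mem' := fun _ => rfl
      add_mem' := fun hx hy hg => by rw [hx hg, hy hg, add_zero]
      smul_mem' := fun c x hx hg => by rw [hx hg, smul_zero] }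
  independent := by
    classical
    refine iSupIndep_of_proj _ (fun g => if g = 1 then LinearMap.id else 0) ?_ ?_
    · intro g x hx
      by_cases h : g = 1
      · simp [h]
      · simp [hx h]
    · intro g h hne x hx
      by_cases h1 : g = 1
      · rw [hx (fun e => hne (e.trans h1.symm)), map_zero]
      · simp [h1]
  iSup_eq_top := by
    rw [eq_top_iff]
    exact fun x _ => Submodule.mem_iSup_of_mem (1 : G) (fun h => absurd rfl h)

lemma unit_eq_zero {a : G} {c : (unit ω).carrier} (hc : c ∈ (unit ω).grading a) (h : a ≠ 1) :
    c = 0 := hc h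

variable [Fintype G]

/-- The tensor product of graded vector spaces. -/
def tensor (V W : VecG k ω) : VecG k ω where
  carrier := V.carrier ⊗[k] W.carrier
  grading := tensorGrading V W
  independent := tensorGrading_independent V W
  iSup_eq_top := tensorGrading_iSup V W

/-- The pure tensor `x ⊗ y`, as an element of `tensor V W`. -/
def tm {V W : VecG k ω} (x : V.carrier) (y : W.carrier) : (tensor V W).carrier := x ⊗ₜ[k] y

lemma tm_mem {V W : VecG k ω} {a b : G} {x : V.carrier} {y : W.carrier}
    (hx : x ∈ V.grading a) (hy : y ∈ W.grading b) : tm x y ∈ (tensor V W).grading (a * b) :=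
  tmul_mem V W hx hy

lemma tm_smul {V W : VecG k ω} (c : k) (x : V.carrier) (y : W.carrier) :
    tm x (c • y) = c • tm x y := TensorProduct.tmul_smul c x y

lemma smul_tm {V W : VecG k ω} (c : k) (x : V.carrier) (y : W.carrier) :
    tm (c • x) y = c • tm x y := TensorProduct.smul_tmul' c x y

lemma zero_tm {V W : VecG k ω} (y : W.carrier) : tm (0 : V.carrier) y = 0 :=
  TensorProduct.zero_tmul _ y

lemma tm_zero {V W : VecG k ω} (x : V.carrier) : tm x (0 : W.carrier) = 0 :=
  TensorProduct.tmul_zero _ x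

lemma add_tm {V W : VecG k ω} (x x' : V.carrier) (y : W.carrier) :
    tm (x + x') y = tm x y + tm x' y := TensorProduct.add_tmul x x' y

lemma tm_add {V W : VecG k ω} (x : V.carrier) (y y' : W.carrier) :
    tm x (y + y') = tm x y + tm x y' := TensorProduct.tmul_add x y y'

lemma tm_mem_of {V W : VecG k ω} {M : Type*} [AddCommGroup M] [Module k M]
    {f : (tensor V W).carrier →ₗ[k] M} {S : Submodule k M} {g : G}
    (h : ∀ a b, a * b = g → ∀ x ∈ V.grading a, ∀ y ∈ W.grading b, f (tm x y) ∈ S) :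
    ∀ t ∈ (tensor V W).grading g, f t ∈ S := fun _ ht =>
  (tensorGrading_le (S := S.comap f) h : tensorGrading V W g ≤ S.comap f) ht

lemma tm_mem_of₃ {U V W : VecG k ω} {M : Type*} [AddCommGroup M] [Module k M]
    {f : (tensor (tensor U V) W).carrier →ₗ[k] M} {S : Submodule k M} {g : G}
    (h : ∀ a b d, (a * b) * d = g → ∀ x ∈ U.grading a, ∀ y ∈ V.grading b, ∀ z ∈ W.grading d,
      f (tm (tm x y) z) ∈ S) :
    ∀ t ∈ (tensor (tensor U V) W).grading g, f t ∈ S :=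
  tm_mem_of fun _ d hed t ht z hz =>
    tm_mem_of (f := f ∘ₗ (TensorProduct.mk k (tensor U V).carrier W.carrier).flip z)
      (fun a b hab x hx y hy => h a b d (hab ▸ hed) x hx y hy z hz) t ht

lemma tm_mem_of₃' {U V W : VecG k ω} {M : Type*} [AddCommGroup M] [Module k M]
    {f : (tensor U (tensor V W)).carrier →ₗ[k] M} {S : Submodule k M} {g : G}
    (h : ∀ a b d, a * (b * d) = g → ∀ x ∈ U.grading a, ∀ y ∈ V.grading b, ∀ z ∈ W.grading d,
      f (tm x (tm y z)) ∈ S) :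
    ∀ t ∈ (tensor U (tensor V W)).grading g, f t ∈ S :=
  tm_mem_of fun a _ hae x hx t ht =>
    tm_mem_of (f := f ∘ₗ TensorProduct.mk k U.carrier (tensor V W).carrier x)
      (fun b d hbd y hy z hz => h a b d (hbd ▸ hae) x hx y hy z hz) t ht

/-- Linear maps out of a tensor product agree if they agree on homogeneous pure tensors. -/
lemma tm_ext {V W : VecG k ω} {M : Type*} [AddCommGroup M] [Module k M]
    {f f' : (tensor V W).carrier →ₗ[k] M}
    (h : ∀ a b, ∀ x ∈ V.grading a, ∀ y ∈ W.grading b, f (tm x y) = f' (tm x y)) : f = f' :=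
  lin_ext fun _ _ ht => LinearMap.mem_eqLocus.1
    ((tensorGrading_le (S := LinearMap.eqLocus f f') fun a b _ x hx y hy => h a b x hx y hy) ht)

lemma tm_ext₃ {U V W : VecG k ω} {M : Type*} [AddCommGroup M] [Module k M]
    {f f' : (tensor (tensor U V) W).carrier →ₗ[k] M}
    (h : ∀ a b d, ∀ x ∈ U.grading a, ∀ y ∈ V.grading b, ∀ z ∈ W.grading d,
      f (tm (tm x y) z) = f' (tm (tm x y) z)) : f = f' :=
  tm_ext fun _ d t _ z hz => LinearMap.congr_fun
    (tm_ext (f := f ∘ₗ (TensorProduct.mk k (tensor U V).carrier W.carrier).flip z)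
      (f' := f' ∘ₗ (TensorProduct.mk k (tensor U V).carrier W.carrier).flip z)
      fun a b x hx y hy => h a b d x hx y hy z hz) t

lemma tm_ext₃' {U V W : VecG k ω} {M : Type*} [AddCommGroup M] [Module k M]
    {f f' : (tensor U (tensor V W)).carrier →ₗ[k] M}
    (h : ∀ a b d, ∀ x ∈ U.grading a, ∀ y ∈ V.grading b, ∀ z ∈ W.grading d,
      f (tm x (tm y z)) = f' (tm x (tm y z))) : f = f' :=
  tm_ext fun a _ x hx t _ => LinearMap.congr_fun
    (tm_ext (f := f ∘ₗ TensorProduct.mk k U.carrier (tensor V W).carrier x)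
      (f' := f' ∘ₗ TensorProduct.mk k U.carrier (tensor V W).carrier x)
      fun b d y hy z hz => h a b d x hx y hy z hz) t

lemma tm_ext₄ {T U V W : VecG k ω} {M : Type*} [AddCommGroup M] [Module k M]
    {f f' : (tensor (tensor (tensor T U) V) W).carrier →ₗ[k] M}
    (h : ∀ e a b d, ∀ t ∈ T.grading e, ∀ x ∈ U.grading a, ∀ y ∈ V.grading b, ∀ z ∈ W.grading d,
      f (tm (tm (tm t x) y) z) = f' (tm (tm (tm t x) y) z)) : f = f' :=
  tm_ext fun _ d s _ z hz => LinearMap.congr_fun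
    (tm_ext₃ (f := f ∘ₗ (TensorProduct.mk k (tensor (tensor T U) V).carrier W.carrier).flip z)
      (f' := f' ∘ₗ (TensorProduct.mk k (tensor (tensor T U) V).carrier W.carrier).flip z)
      fun e a b t ht x hx y hy => h e a b d t ht x hx y hy z hz) s

/-- The tensor product of morphisms. -/
def tensorHom {V V' W W' : VecG k ω} (f : V ⟶ V') (h : W ⟶ W') : tensor V W ⟶ tensor V' W' :=
  mkHom (TensorProduct.map (lin f) (lin h)) fun _ => tm_mem_of fun a b hab x hx y hy => by
    subst hab
    exact tm_mem (lin_mem f hx) (lin_mem h hy)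

lemma tensorHom_tm {V V' W W' : VecG k ω} (f : V ⟶ V') (h : W ⟶ W') (x : V.carrier)
    (y : W.carrier) : lin (tensorHom f h) (tm x y) = tm (lin f x) (lin h y) := rfl

/-- The linear map `(x ⊗ y) ⊗ z ↦ ω(a, b, d) • x ⊗ (y ⊗ z)` for `x, y, z` homogeneous of
degrees `a, b, d`, as a sum over all triples of degrees. -/
noncomputable def assocLin (U V W : VecG k ω) :
    (tensor (tensor U V) W).carrier →ₗ[k] (tensor U (tensor V W)).carrier :=
  ∑ a : G, ∑ b : G, ∑ d : G, (ω.toFun a b d : k) •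
    ((TensorProduct.assoc k U.carrier V.carrier W.carrier).toLinearMap ∘ₗ
      TensorProduct.map (TensorProduct.map (U.proj a) (V.proj b)) (W.proj d))

/-- The linear map `x ⊗ (y ⊗ z) ↦ ω(a, b, d)⁻¹ • (x ⊗ y) ⊗ z` for `x, y, z` homogeneous of
degrees `a, b, d`. -/
noncomputable def assocInvLin (U V W : VecG k ω) :
    (tensor U (tensor V W)).carrier →ₗ[k] (tensor (tensor U V) W).carrier :=
  ∑ a : G, ∑ b : G, ∑ d : G, ((ω.toFun a b d)⁻¹ : kˣ).val •
    ((TensorProduct.assoc k U.carrier V.carrier W.carrier).symm.toLinearMap ∘ₗ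
      TensorProduct.map (U.proj a) (TensorProduct.map (V.proj b) (W.proj d)))

lemma sum₃_apply {G : Type*} [Fintype G] {M N : Type*} [AddCommGroup M] [Module k M] [AddCommGroup N] [Module k N]
    (F : G → G → G → M →ₗ[k] N) (x : M) :
    (∑ a : G, ∑ b : G, ∑ d : G, F a b d) x = ∑ a : G, ∑ b : G, ∑ d : G, F a b d x := by
  simp only [LinearMap.sum_apply]

lemma sum_proj {M : Type*} [AddCommGroup M] [Module k M] (V : VecG k ω) {a : G} {x : V.carrier}
    (hx : x ∈ V.grading a) (F : G → V.carrier → M) (hF : ∀ g, F g 0 = 0) :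
    ∑ g : G, F g (V.proj g x) = F a x := by
  classical
  rw [Finset.sum_eq_single a, proj_self V hx]
  · intro g _ hg
    rw [proj_ne V (Ne.symm hg) hx, hF]
  · simp

lemma assocLin_tm {U V W : VecG k ω} {a b d : G}
    {x : U.carrier} {y : V.carrier} {z : W.carrier}
    (hx : x ∈ U.grading a) (hy : y ∈ V.grading b) (hz : z ∈ W.grading d) :
    assocLin U V W (tm (tm x y) z) = (ω.toFun a b d : k) • tm x (tm y z) := by
  have h : assocLin U V W (tm (tm x y) z) = ∑ a : G, ∑ b : G, ∑ d : G, (ω.toFun a b d : k) •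
      tm (U.proj a x) (tm (V.proj b y) (W.proj d z)) := by
    exact (sum₃_apply _ _).trans rfl
  rw [h, sum_proj U hx (fun a x => ∑ b : G, ∑ d : G, (ω.toFun a b d : k) •
      tm x (tm (V.proj b y) (W.proj d z))) (by simp [zero_tm]),
    sum_proj V hy (fun b y => ∑ d : G, (ω.toFun a b d : k) •
      tm x (tm y (W.proj d z))) (by simp [zero_tm, tm_zero]),
    sum_proj W hz (fun d z => (ω.toFun a b d : k) • tm x (tm y z)) (by simp [tm_zero])]

lemma assocInvLin_tm {U V W : VecG k ω} {a b d : G}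
    {x : U.carrier} {y : V.carrier} {z : W.carrier}
    (hx : x ∈ U.grading a) (hy : y ∈ V.grading b) (hz : z ∈ W.grading d) :
    assocInvLin U V W (tm x (tm y z)) = ((ω.toFun a b d)⁻¹ : kˣ).val • tm (tm x y) z := by
  have h : assocInvLin U V W (tm x (tm y z)) =
      ∑ a : G, ∑ b : G, ∑ d : G, ((ω.toFun a b d)⁻¹ : kˣ).val •
        tm (tm (U.proj a x) (V.proj b y)) (W.proj d z) := by
    exact (sum₃_apply _ _).trans rfl
  rw [h, sum_proj U hx (fun a x => ∑ b : G, ∑ d : G, ((ω.toFun a b d)⁻¹ : kˣ).val •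
      tm (tm x (V.proj b y)) (W.proj d z)) (by simp [zero_tm]),
    sum_proj V hy (fun b y => ∑ d : G, ((ω.toFun a b d)⁻¹ : kˣ).val •
      tm (tm x y) (W.proj d z)) (by simp [zero_tm, tm_zero]),
    sum_proj W hz (fun d z => ((ω.toFun a b d)⁻¹ : kˣ).val • tm (tm x y) z) (by simp [tm_zero])]

/-- The associator of `Vec_G^ω`. -/
noncomputable def assoc (U V W : VecG k ω) :
    tensor (tensor U V) W ≅ tensor U (tensor V W) where
  hom := mkHom (assocLin U V W) fun _ => tm_mem_of₃ fun a b d h x hx y hy z hz => by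
    subst h
    rw [assocLin_tm hx hy hz, mul_assoc]
    exact Submodule.smul_mem _ _ (tm_mem hx (tm_mem hy hz))
  inv := mkHom (assocInvLin U V W) fun _ => tm_mem_of₃' fun a b d h x hx y hy z hz => by
    subst h
    rw [assocInvLin_tm hx hy hz, ← mul_assoc]
    exact Submodule.smul_mem _ _ (tm_mem (tm_mem hx hy) hz)
  hom_inv_id := hom_ext <| tm_ext₃ fun a b d x hx y hy z hz => by
    rw [lin_comp, LinearMap.comp_apply, lin_mkHom, lin_mkHom, assocLin_tm hx hy hz, map_smul,
      assocInvLin_tm hx hy hz, smul_smul, Units.mul_inv, one_smul]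
    rfl
  inv_hom_id := hom_ext <| tm_ext₃' fun a b d x hx y hy z hz => by
    rw [lin_comp, LinearMap.comp_apply, lin_mkHom, lin_mkHom, assocInvLin_tm hx hy hz, map_smul,
      assocLin_tm hx hy hz, smul_smul, Units.inv_mul, one_smul]
    rfl

/-- On homogeneous elements of degrees `a, b, d` the associator is
`(x ⊗ y) ⊗ z ↦ ω(a, b, d) • x ⊗ (y ⊗ z)`. -/
lemma assoc_hom_tm {U V W : VecG k ω} {a b d : G}
    {x : U.carrier} {y : V.carrier} {z : W.carrier}
    (hx : x ∈ U.grading a) (hy : y ∈ V.grading b) (hz : z ∈ W.grading d) :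
    lin (assoc U V W).hom (tm (tm x y) z) = (ω.toFun a b d : k) • tm x (tm y z) :=
  assocLin_tm hx hy hz

/-- The linear map `c ⊗ x ↦ c • x`. -/
noncomputable def lidLin (V : VecG k ω) : (tensor (unit ω) V).carrier →ₗ[k] V.carrier :=
  (TensorProduct.lid k V.carrier).toLinearMap

/-- The linear map `x ⊗ c ↦ c • x`. -/
noncomputable def ridLin (V : VecG k ω) : (tensor V (unit ω)).carrier →ₗ[k] V.carrier :=
  (TensorProduct.rid k V.carrier).toLinearMap

/-- The left unit isomorphism `c ⊗ x ↦ c • x`. -/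
noncomputable def lUnitor (V : VecG k ω) : tensor (unit ω) V ≅ V where
  hom := mkHom (lidLin V) fun _ =>
    tm_mem_of fun a b hab c hc y hy => by
      subst hab
      by_cases h : a = 1
      · subst h
        rw [one_mul]
        exact Submodule.smul_mem _ _ hy
      · rw [unit_eq_zero hc h, zero_tm, map_zero]
        exact Submodule.zero_mem _
  inv := mkHom (TensorProduct.lid k V.carrier).symm.toLinearMap fun g x hx => by
    have := tm_mem (V := unit ω) (a := 1) (x := (1 : k)) (fun h => absurd rfl h) hx
    rw [one_mul] at this
    exact this
  hom_inv_id := hom_ext <| LinearMap.ext fun x => (TensorProduct.lid k V.carrier).symm_apply_apply x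
  inv_hom_id := hom_ext <| LinearMap.ext fun x => (TensorProduct.lid k V.carrier).apply_symm_apply x

/-- The right unit isomorphism `x ⊗ c ↦ c • x`. -/
noncomputable def rUnitor (V : VecG k ω) : tensor V (unit ω) ≅ V where
  hom := mkHom (ridLin V) fun _ =>
    tm_mem_of fun a b hab y hy c hc => by
      subst hab
      by_cases h : b = 1
      · subst h
        rw [mul_one]
        exact Submodule.smul_mem _ _ hy
      · rw [unit_eq_zero hc h, tm_zero, map_zero]
        exact Submodule.zero_mem _
  inv := mkHom (TensorProduct.rid k V.carrier).symm.toLinearMap fun g x hx => by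
    have := tm_mem (W := unit ω) (b := 1) (y := (1 : k)) hx (fun h => absurd rfl h)
    rw [mul_one] at this
    exact this
  hom_inv_id := hom_ext <| LinearMap.ext fun x => (TensorProduct.rid k V.carrier).symm_apply_apply x
  inv_hom_id := hom_ext <| LinearMap.ext fun x => (TensorProduct.rid k V.carrier).apply_symm_apply x

lemma lUnitor_tm {V : VecG k ω} (c : (unit ω).carrier) (x : V.carrier) :
    lin (lUnitor V).hom (tm c x) = (show k from c) • x := rfl

lemma rUnitor_tm {V : VecG k ω} (x : V.carrier) (c : (unit ω).carrier) :
    lin (rUnitor V).hom (tm x c) = (show k from c) • x := rfl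

lemma assoc_naturality {X₁ X₂ X₃ Y₁ Y₂ Y₃ : VecG k ω} (f₁ : X₁ ⟶ Y₁) (f₂ : X₂ ⟶ Y₂)
    (f₃ : X₃ ⟶ Y₃) : tensorHom (tensorHom f₁ f₂) f₃ ≫ (assoc Y₁ Y₂ Y₃).hom =
      (assoc X₁ X₂ X₃).hom ≫ tensorHom f₁ (tensorHom f₂ f₃) :=
  hom_ext <| tm_ext₃ fun a b d x hx y hy z hz => by
    simp only [lin_comp, LinearMap.comp_apply]
    rw [assoc_hom_tm hx hy hz, map_smul]
    simp only [tensorHom_tm]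
    rw [assoc_hom_tm (lin_mem f₁ hx) (lin_mem f₂ hy) (lin_mem f₃ hz)]

lemma pentagon (W X Y Z : VecG k ω) :
    tensorHom (assoc W X Y).hom (𝟙 Z) ≫ (assoc W (tensor X Y) Z).hom ≫
        tensorHom (𝟙 W) (assoc X Y Z).hom =
      (assoc (tensor W X) Y Z).hom ≫ (assoc W X (tensor Y Z)).hom :=
  hom_ext <| tm_ext₄ fun a b c d w hw x hx y hy z hz => by
    have h := congrArg Units.val (ω.cocycle a b c d)
    simp only [Units.val_mul] at h
    simp only [lin_comp, LinearMap.comp_apply]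
    rw [tensorHom_tm, assoc_hom_tm hw hx hy, assoc_hom_tm (tm_mem hw hx) hy hz, smul_tm,
      map_smul, map_smul, map_smul, lin_id, LinearMap.id_apply, assoc_hom_tm hw (tm_mem hx hy) hz,
      assoc_hom_tm hw hx (tm_mem hy hz), map_smul, tensorHom_tm, assoc_hom_tm hx hy hz, tm_smul,
      smul_smul, smul_smul, smul_smul, lin_id, LinearMap.id_apply, h]

lemma triangle (X Y : VecG k ω) :
    (assoc X (unit ω) Y).hom ≫ tensorHom (𝟙 X) (lUnitor Y).hom =
      tensorHom (rUnitor X).hom (𝟙 Y) :=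
  hom_ext <| tm_ext₃ fun a b d x hx c hc y hy => by
    simp only [lin_comp, LinearMap.comp_apply]
    by_cases h : b = 1
    · subst h
      rw [assoc_hom_tm hx hc hy, map_smul, tensorHom_tm, tensorHom_tm, lUnitor_tm, rUnitor_tm,
        ω.one_mid, Units.val_one, one_smul, tm_smul, smul_tm]
      rfl
    · rw [unit_eq_zero hc h, tm_zero, zero_tm, map_zero, map_zero, map_zero]

noncomputable instance : MonoidalCategoryStruct (VecG k ω) where
  tensorObj := tensor
  tensorUnit := unit ω
  tensorHom := tensorHom
  whiskerLeft V _ _ f := tensorHom (𝟙 V) f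
  whiskerRight f W := tensorHom f (𝟙 W)
  associator := assoc
  leftUnitor := lUnitor
  rightUnitor := rUnitor

noncomputable instance : MonoidalCategory (VecG k ω) :=
  MonoidalCategory.ofTensorHom
    (id_tensorHom_id := fun _ _ => hom_ext TensorProduct.map_id)
    (id_tensorHom := fun _ _ _ _ => rfl)
    (tensorHom_id := fun _ _ => rfl)
    (tensorHom_comp_tensorHom := fun f₁ f₂ g₁ g₂ =>
      hom_ext (TensorProduct.map_comp (lin g₁) (lin g₂) (lin f₁) (lin f₂)).symm)
    (associator_naturality := assoc_naturality)
    (leftUnitor_naturality := fun f =>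
      hom_ext <| TensorProduct.ext' fun c x => ((lin f).map_smul c x).symm)
    (rightUnitor_naturality := fun f =>
      hom_ext <| TensorProduct.ext' fun x c => ((lin f).map_smul c x).symm)
    (pentagon := pentagon)
    (triangle := triangle)

end VecG
/-! ### Fusion categories -/

variable (k : Type u) [Field k] (C : Type w) [Category.{v} C] [Abelian C] [MonoidalCategory C]

instance hasFiniteBiproducts_of_abelian {C : Type*} [Category* C] [Abelian C] :
    HasFiniteBiproducts C := Abelian.hasFiniteBiproducts

/-- The set of isomorphism classes of objects with a given property. -/
def isoClasses {C : Type w} [Category.{v} C] (P : ObjectProperty C) : Set (Skeleton C) :=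
  {c | ∃ X, P X ∧ toSkeleton X = c}

/-- A `k`-linear abelian rigid monoidal category with `k`-bilinear tensor product is a fusion
category over `k` if it is semisimple with finitely many isomorphism classes of simple objects,
its spaces of morphisms are finite-dimensional, and its unit object is simple. -/
class IsFusion [Linear k C] [MonoidalPreadditive C] [MonoidalLinear k C] [RigidCategory C] :
    Prop where
  finite_hom : ∀ X Y : C, Module.Finite k (X ⟶ Y)
  semisimple : ∀ X : C, ∃ (n : ℕ) (S : Fin n → C), (∀ i, Simple (S i)) ∧ Nonempty (X ≅ ⨁ S)
  finite_simples : (isoClasses (fun X : C => Simple X)).Finite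
  simple_unit : Simple (𝟙_ C)

/-- Equivalence as fusion categories: there is a `k`-linear monoidal functor
which is an equivalence of categories. -/
def TensorEquivalent (D : Type*) [Category* D] [Preadditive D] [Linear k D] [MonoidalCategory D]
    (E : Type*) [Category* E] [Preadditive E] [Linear k E] [MonoidalCategory E] : Prop :=
  ∃ F : D ⥤ E, F.IsEquivalence ∧ F.Additive ∧ F.Linear k ∧ Nonempty F.Monoidal

/-! ### Frobenius-Perron dimension -/

/-- The relation `[X₂] = [X₁] + [X₃]` for each short exact sequence `0 → X₁ → X₂ → X₃ → 0`. -/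
inductive K0Rel : MonoidAlgebra ℤ (Skeleton C) → MonoidAlgebra ℤ (Skeleton C) → Prop
  | mk (S : ShortComplex C) (hS : S.ShortExact) :
    K0Rel (MonoidAlgebra.of ℤ _ (toSkeleton S.X₂))
      (MonoidAlgebra.of ℤ _ (toSkeleton S.X₁) + MonoidAlgebra.of ℤ _ (toSkeleton S.X₃))

/-- The Grothendieck ring: generated by the isomorphism classes of objects, with the product
induced by the tensor product, modulo short exact sequences. -/
def K0 : Type w := RingQuot (K0Rel C)

noncomputable instance : Ring (K0 C) := inferInstanceAs (Ring (RingQuot (K0Rel C)))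

variable {C}

/-- The class of an object in the Grothendieck ring. -/
noncomputable def K0.cls (X : C) : K0 C :=
  RingQuot.mkRingHom (K0Rel C) (MonoidAlgebra.of ℤ _ (toSkeleton X))

/-- The property which characterizes the Frobenius-Perron dimension among the ring homomorphisms
`K(C) → ℝ`. -/
def IsFPdim (φ : K0 C →+* ℝ) : Prop := ∀ X : C, ¬ IsZero X → 1 ≤ φ (K0.cls X)

open Classical in
/-- The Frobenius-Perron dimension of an object: its value under the unique ring homomorphism
`K(C) → ℝ` which is at least `1` on nonzero objects. (If there is no such unique homomorphism,
the value is `0`; this does not happen for fusion categories.) -/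
noncomputable def FPdim (X : C) : ℝ :=
  if h : ∃! φ : K0 C →+* ℝ, IsFPdim φ then h.choose (K0.cls X) else 0

/-! ### Pointed and generalized Tambara-Yamagami fusion categories -/

/-- A simple object `X` is invertible if `X ⊗ X* ≅ 𝟙`. -/
def IsInvertible [RigidCategory C] (X : C) : Prop := Simple X ∧ Nonempty (X ⊗ Xᘁ ≅ 𝟙_ C)

variable (C)

/-- Every simple object is invertible. -/
def IsPointed [RigidCategory C] : Prop := ∀ X : C, Simple X → IsInvertible X

/-- Not pointed, and the tensor product of two non-invertible simple objects is a direct sum of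
invertible objects. -/
def IsGeneralizedTY [RigidCategory C] : Prop :=
  ¬ IsPointed C ∧ ∀ X Y : C, Simple X → Simple Y → ¬ IsInvertible X → ¬ IsInvertible Y →
    ∃ (n : ℕ) (S : Fin n → C), (∀ i, IsInvertible (S i)) ∧ Nonempty (X ⊗ Y ≅ ⨁ S)

/-! ### The adjoint subcategory -/

variable {C}

/-- `P` defines a fusion subcategory: a full replete subcategory which contains the unit object
and is closed under tensor products, finite direct sums, direct summands and duals. -/
structure IsFusionSubcategory [RigidCategory C] (P : ObjectProperty C) : Prop where
  unit : P (𝟙_ C)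
  tensor : ∀ X Y : C, P X → P Y → P (X ⊗ Y)
  zero : ∀ X : C, IsZero X → P X
  biprod : ∀ X Y : C, P X → P Y → P (X ⊞ Y)
  summand : ∀ (X Y : C) (i : X ⟶ Y) (r : Y ⟶ X), i ≫ r = 𝟙 X → P Y → P X
  rightDual : ∀ X : C, P X → P Xᘁ
  leftDual : ∀ X : C, P X → P (ᘁX)

/-- The smallest fusion subcategory which contains the given objects. -/
def generated [RigidCategory C] (S : ObjectProperty C) : ObjectProperty C := fun X =>
  ∀ P : ObjectProperty C, IsFusionSubcategory P → (∀ Y, S Y → P Y) → P X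

/-- The simple object `Y` is a constituent of `X`. -/
def IsConstituent (Y X : C) : Prop := Simple Y ∧ ∃ f : Y ⟶ X, f ≠ 0

variable (C)

/-- The adjoint subcategory `C_ad`: generated by the simple constituents of the objects
`X ⊗ X*` with `X` simple. -/
def adjoint [RigidCategory C] : ObjectProperty C :=
  generated fun Y => ∃ X : C, Simple X ∧ IsConstituent Y (X ⊗ Xᘁ)

instance [RigidCategory C] : (adjoint C).IsMonoidal where
  prop_unit := fun _ hP _ => hP.unit
  prop_tensor _ _ h₁ h₂ := fun P hP hS => hP.tensor _ _ (h₁ P hP hS) (h₂ P hP hS)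

/-! ### The universal grading group -/

/-- The relations of the universal grading group: `X * Y = Z` whenever the simple object `Z`
is a constituent of `X ⊗ Y`. -/
def gradingRels : Set (FreeGroup {X : C // Simple X}) :=
  {r | ∃ X Y Z : {X : C // Simple X}, IsConstituent Z.1 (X.1 ⊗ Y.1) ∧
    r = FreeGroup.of X * FreeGroup.of Y * (FreeGroup.of Z)⁻¹}

/-- The universal grading group `U(C)`: generated by the degrees of the simple objects,
where the degree is multiplicative. (A grading of `C` by a group `G` is the same as a homomorphism
from this group to `G`, and it is faithful if and only if this homomorphism is surjective.) -/
abbrev UniversalGradingGroup : Type w := PresentedGroup (gradingRels C)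

variable {C}

/-- The degree of a simple object in the universal grading. -/
def universalDegree (X : C) (hX : Simple X) : UniversalGradingGroup C :=
  PresentedGroup.of ⟨X, hX⟩

/-! ### Gradings -/

variable (C)

/-- A grading `C = ⨁_{g ∈ G} C_g` by a finite group: full replete subcategories `C_g` without nonzero
morphisms between different ones, such that every object is a direct sum of objects of the `C_g`,
and `C_g ⊗ C_h ⊆ C_{gh}`. -/
structure Grading (G : Type*) [Group G] [Finite G] where
  component : G → ObjectProperty C
  of_iso : ∀ (g : G) (X Y : C), (X ≅ Y) → component g X → component g Y
  hom_eq_zero : ∀ g h : G, g ≠ h → ∀ X Y : C, component g X → component h Y →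
    ∀ f : X ⟶ Y, f = 0
  decomposition : ∀ X : C, ∃ F : G → C, (∀ g, component g (F g)) ∧ Nonempty (X ≅ ⨁ F)
  tensor : ∀ (g h : G) (X Y : C), component g X → component h Y → component (g * h) (X ⊗ Y)

namespace Grading

variable {C} {G : Type*} [Group G] [Finite G] (Γ : Grading C G)

/-- Every component is nonzero. -/
def Faithful : Prop := ∀ g, ∃ X : C, Γ.component g X ∧ ¬ IsZero X

lemma unit_mem [MonoidalPreadditive C] : Γ.component 1 (𝟙_ C) := by
  classical
  have := Fintype.ofFinite G
  obtain ⟨F, hF, ⟨e⟩⟩ := Γ.decomposition (𝟙_ C)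
  let p : ∀ g, 𝟙_ C ⟶ F g := fun g => e.hom ≫ biproduct.π F g
  let i : ∀ g, F g ⟶ 𝟙_ C := fun g => biproduct.ι F g ≫ e.inv
  have hip : ∀ g, i g ≫ p g = 𝟙 (F g) := fun g => by simp [i, p]
  have hsum : ∑ g, p g ≫ i g = 𝟙 (𝟙_ C) := by
    have ht : ∑ g, biproduct.π F g ≫ biproduct.ι F g = 𝟙 (⨁ F) := by
      refine biproduct.hom_ext' _ _ fun h => ?_
      rw [Preadditive.comp_sum, Finset.sum_eq_single h, biproduct.ι_π_self_assoc, Category.comp_id]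
      · intro g _ hg
        rw [biproduct.ι_π_ne_assoc _ hg.symm, zero_comp]
      · simp
    have h := congrArg (fun f : (⨁ F) ⟶ (⨁ F) => e.hom ≫ f ≫ e.inv) ht
    simpa [Preadditive.sum_comp, Preadditive.comp_sum, p, i] using h
  have h0 : ∀ g h, g ≠ 1 → 𝟙 (F h ⊗ F g) = 0 := fun g h hg => by
    have hz : F h ◁ p g = 0 := Γ.hom_eq_zero h (h * g) (by simpa using hg) _ _
      (Γ.of_iso h _ _ (ρ_ (F h)).symm (hF h)) (Γ.tensor h g _ _ (hF h) (hF g)) _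
    rw [← MonoidalCategory.whiskerLeft_id, ← hip g, MonoidalCategory.whiskerLeft_comp, hz, comp_zero]
  have h1 : ∀ g, g ≠ 1 → p g ≫ i g = 0 := fun g hg => by
    have hz : 𝟙 (𝟙_ C ⊗ F g) = 0 := by
      rw [← MonoidalCategory.id_whiskerRight, ← hsum, sum_whiskerRight]
      refine Finset.sum_eq_zero fun h _ => ?_
      rw [MonoidalCategory.comp_whiskerRight, ← Category.id_comp (i h ▷ F g), h0 g h hg,
        zero_comp, comp_zero]
    have hz' : 𝟙 (F g) = 0 := by
      rw [← (λ_ (F g)).inv_hom_id, ← Category.id_comp (λ_ (F g)).hom, hz, zero_comp, comp_zero]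
    rw [← Category.id_comp (i g), hz', zero_comp, comp_zero]
  have hpi : p 1 ≫ i 1 = 𝟙 _ := by
    rw [← hsum, Finset.sum_eq_single 1 (fun g _ hg => h1 g hg) (by simp)]
  exact Γ.of_iso 1 _ _ ⟨i 1, p 1, hip 1, hpi⟩ (hF 1)

instance [MonoidalPreadditive C] : (Γ.component 1).IsMonoidal where
  prop_unit := Γ.unit_mem
  prop_tensor X Y hX hY := by simpa using Γ.tensor 1 1 X Y hX hY

end Grading

/-- The given grading is the universal grading: its trivial component is `C_ad`, and its degrees
identify `U(C)` with `G`. -/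
def Grading.IsUniversal {C : Type w} [Category.{v} C] [Abelian C] [MonoidalCategory C]
    [RigidCategory C] {G : Type*} [Group G] [Finite G] (Γ : Grading C G) : Prop :=
  Γ.component 1 = adjoint C ∧
    ∃ e : UniversalGradingGroup C ≃* G, ∀ (g : G) (X : C) (hX : Simple X),
      Γ.component g X → e (universalDegree X hX) = g

end Fusion

/-! The trivial component has two simple objects, the unit and an object `δ` with `δ ⊗ δ ≅ 𝟙_ C`.
For a simple `X`, the object `X ⊗ Xᘁ` lies in the trivial component. It contains the unit once, and
contains `δ` with multiplicity `dim Hom(δ ⊗ X, X)`, which is 1 or 0 according to whether `δ ⊗ X ≅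
X`. Everything is governed by this dichotomy (`IsFixed`): `X` is invertible exactly when it is not
fixed, and otherwise `X ⊗ Xᘁ ≅ 𝟙_ C ⊞ δ`. Likewise `Y ⊗ Xᘁ` contains the unit or `δ` whenever `X`
and `Y` are simple of the same degree, so the simple objects of a component are `X` and `δ ⊗ X`.

A fixed simple `X` kills the obstruction. An isomorphism `δ ⊗ X ≅ X` is an action of `δ` on a simple
object, and comparing two ways of letting `δ` act three times shows that the associator scalar of
`δ` is 1 (`pairing_scalar_eq_one`). A normalized cocycle on a group of order two has only this one
free value, so the cocycle is literally trivial unless the category is pointed.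

If fixed simples exist, the product of two of them is a sum of two simples that are not fixed
(`exists_iso_biproduct_of_isFixed`), which is the Tambara–Yamagami condition. Let `N` be the set of
degrees of fixed simples. Translation by an element of `N` exchanges `N` with its complement, so `G`
has order `2n` with `n = |N|`. A degree in `N` carries one simple object and any other degree
carries two (`ncard_isoClasses`). The weight `√2` on fixed simples and 1 on the others is
multiplicative and forced, hence is the Frobenius–Perron dimension (`FPdim_simple`). Finally, `𝟙_ C`
and `δ` both occur in `X ⊗ Xᘁ` for fixed `X`. This makes the trivial component the adjoint
subcategory and makes the map from the universal grading group to `G` injective (`isUniversal`). -/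

namespace Fusion

universe w' v' u'

/-! ### Dimensions of spaces of morphisms in semisimple categories -/

section Dimensions

/-- The dimension of the space of morphisms from `X` to `Y`. -/
noncomputable def homDim (k : Type u') [Field k] {C : Type w'} [Category.{v'} C] [Preadditive C]
    [Linear k C] (X Y : C) : ℕ := Module.finrank k (X ⟶ Y)

variable (k : Type u') [Field k] {C : Type w'} [Category.{v'} C]

section Preadditive

variable [Preadditive C] [Linear k C]

lemma homDim_congr {X X' Y Y' : C} (e : X ≅ X') (e' : Y ≅ Y') :
    homDim k X Y = homDim k X' Y' :=
  LinearEquiv.finrank_eq (Linear.homCongr k e e')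

lemma homDim_eq_zero {X Y : C} (h : ∀ f : X ⟶ Y, f = 0) : homDim k X Y = 0 :=
  haveI := subsingleton_of_forall_eq (0 : X ⟶ Y) h
  Module.finrank_zero_of_subsingleton

lemma homDim_of_isZero_left {X : C} (h : IsZero X) (Y : C) : homDim k X Y = 0 :=
  homDim_eq_zero k fun f => h.eq_of_src f 0

lemma homDim_of_isZero_right (X : C) {Y : C} (h : IsZero Y) : homDim k X Y = 0 :=
  homDim_eq_zero k fun f => h.eq_of_tgt f 0

lemma homDim_ne_zero [∀ X Y : C, Module.Finite k (X ⟶ Y)] {X Y : C} {f : X ⟶ Y} (hf : f ≠ 0) :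
    homDim k X Y ≠ 0 :=
  (Module.finrank_pos_iff_exists_ne_zero.2 ⟨f, hf⟩).ne'

lemma exists_ne_zero_of_homDim {X Y : C} (h : homDim k X Y ≠ 0) : ∃ f : X ⟶ Y, f ≠ 0 := by
  by_contra! h'
  exact h (homDim_eq_zero k h')

/-- Morphisms into a biproduct, as a linear equivalence. -/
noncomputable def homBiproductEquiv {J : Type*} [Fintype J] (X : C) (F : J → C)
    [HasBiproduct F] : (X ⟶ ⨁ F) ≃ₗ[k] (∀ j, X ⟶ F j) where
  toFun f j := f ≫ biproduct.π F j
  invFun f := biproduct.lift f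
  map_add' _ _ := funext fun _ => by simp
  map_smul' _ _ := funext fun _ => by simp
  left_inv _ := by ext; simp
  right_inv _ := by ext; simp

/-- Morphisms out of a biproduct, as a linear equivalence. -/
noncomputable def biproductHomEquiv {J : Type*} [Fintype J] (F : J → C) (X : C)
    [HasBiproduct F] : (⨁ F ⟶ X) ≃ₗ[k] (∀ j, F j ⟶ X) where
  toFun f j := biproduct.ι F j ≫ f
  invFun f := biproduct.desc f
  map_add' _ _ := funext fun _ => by simp
  map_smul' _ _ := funext fun _ => by simp
  left_inv _ := by ext; simp
  right_inv _ := by ext; simp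

variable [∀ X Y : C, Module.Finite k (X ⟶ Y)]

lemma homDim_biproduct_right {J : Type*} [Fintype J] (X : C) (F : J → C) [HasBiproduct F] :
    homDim k X (⨁ F) = ∑ j, homDim k X (F j) :=
  (LinearEquiv.finrank_eq (homBiproductEquiv k X F)).trans (Module.finrank_pi_fintype k)

lemma homDim_biproduct_left {J : Type*} [Fintype J] (F : J → C) (X : C) [HasBiproduct F] :
    homDim k (⨁ F) X = ∑ j, homDim k (F j) X :=
  (LinearEquiv.finrank_eq (biproductHomEquiv k F X)).trans (Module.finrank_pi_fintype k)

/-- Morphisms into a binary biproduct, as a linear equivalence. -/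
noncomputable def homBiprodEquiv (X Y Z : C) [HasBinaryBiproduct Y Z] :
    (X ⟶ Y ⊞ Z) ≃ₗ[k] ((X ⟶ Y) × (X ⟶ Z)) where
  toFun f := (f ≫ biprod.fst, f ≫ biprod.snd)
  invFun f := biprod.lift f.1 f.2
  map_add' _ _ := by simp
  map_smul' _ _ := by simp
  left_inv _ := by apply biprod.hom_ext <;> simp
  right_inv _ := by simp

lemma homDim_biprod_right (X Y Z : C) [HasBinaryBiproduct Y Z] :
    homDim k X (Y ⊞ Z) = homDim k X Y + homDim k X Z :=
  (LinearEquiv.finrank_eq (homBiprodEquiv k X Y Z)).trans (Module.finrank_prod ..)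

end Preadditive

section Monoidal

variable [Preadditive C] [Linear k C] [MonoidalCategory C] [MonoidalPreadditive C]
  [MonoidalLinear k C]

/-- Duality adjunctions, read as equalities of multiplicities, are the main computational tool
below. -/
lemma homDim_tensor_right_adj (X Y Z : C) [HasRightDual Y] :
    homDim k (X ⊗ Y) Z = homDim k X (Z ⊗ Yᘁ) := by
  let e : (X ⊗ Y ⟶ Z) ≃ₗ[k] (X ⟶ Z ⊗ Yᘁ) :=
    { tensorRightHomEquiv X Y Yᘁ Z with
      map_add' := fun f g => by simp [tensorRightHomEquiv]
      map_smul' := fun c f => by simp [tensorRightHomEquiv] }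
  exact LinearEquiv.finrank_eq e

lemma homDim_tensor_left_adj (X Y Z : C) [HasRightDual Y] :
    homDim k (Yᘁ ⊗ X) Z = homDim k X (Y ⊗ Z) := by
  let e : (Yᘁ ⊗ X ⟶ Z) ≃ₗ[k] (X ⟶ Y ⊗ Z) :=
    { tensorLeftHomEquiv X Y Yᘁ Z with
      map_add' := fun f g => by simp [tensorLeftHomEquiv]
      map_smul' := fun c f => by simp [tensorLeftHomEquiv] }
  exact LinearEquiv.finrank_eq e

end Monoidal

section Semisimple

variable [Abelian C] [Linear k C] [MonoidalCategory C]
    [MonoidalPreadditive C] [MonoidalLinear k C] [RigidCategory C] [IsFusion k C]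

instance finite_hom_of_isFusion (X Y : C) : Module.Finite k (X ⟶ Y) := IsFusion.finite_hom X Y

include k in
variable (C) in
lemma simple_tensorUnit : Simple (𝟙_ C) := IsFusion.simple_unit k

lemma homDim_simple [IsAlgClosed k] (X Y : C) [Simple X] [Simple Y] [Decidable (Nonempty (X ≅ Y))] :
    homDim k X Y = if Nonempty (X ≅ Y) then 1 else 0 := by
  rw [homDim, finrank_hom_simple_simple k X Y]
  congr

lemma homDim_self_simple [IsAlgClosed k] (X : C) [Simple X] : homDim k X X = 1 :=
  finrank_endomorphism_simple_eq_one k X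

omit [MonoidalCategory C] [MonoidalPreadditive C] [MonoidalLinear k C] [RigidCategory C]
  [IsFusion k C] in
lemma homDim_simple_of_isEmpty {X Y : C} [Simple X] [Simple Y] (h : IsEmpty (X ≅ Y)) :
    homDim k X Y = 0 :=
  finrank_hom_simple_simple_eq_zero_of_not_iso k h.false

omit [MonoidalCategory C] [MonoidalPreadditive C] [MonoidalLinear k C] [RigidCategory C]
  [IsFusion k C] in
lemma nonempty_iso_of_homDim {X Y : C} [Simple X] [Simple Y] (h : homDim k X Y ≠ 0) :
    Nonempty (X ≅ Y) :=
  not_isEmpty_iff.1 fun h' => h (homDim_simple_of_isEmpty k h')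

include k in
/-- A nonzero object receives a nonzero morphism from a simple object. -/
lemma exists_simple_hom_ne_zero {X : C} (hX : ¬ IsZero X) :
    ∃ (S : C), Simple S ∧ ∃ f : S ⟶ X, f ≠ 0 := by
  obtain ⟨n, S, hS, ⟨e⟩⟩ := IsFusion.semisimple (k := k) X
  by_contra! h
  refine hX ((IsZero.iff_id_eq_zero X).2 ?_)
  have : e.inv = 0 := by
    ext j
    rw [comp_zero]
    exact h _ (hS j) _
  rw [← e.hom_inv_id, this, comp_zero]

/-- Nonzero objects with a one-dimensional endomorphism algebra are simple. -/
lemma simple_of_homDim_self {X : C} (hX : ¬ IsZero X) (h : homDim k X X ≤ 1) : Simple X := by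
  obtain ⟨n, S, hS, ⟨e⟩⟩ := IsFusion.semisimple (k := k) X
  have h0 : 𝟙 X ≠ 0 := fun h => hX ((IsZero.iff_id_eq_zero X).2 h)
  obtain ⟨j, hj⟩ : ∃ j, biproduct.ι S j ≫ e.inv ≠ 0 := by
    by_contra! h
    refine h0 ?_
    have : e.inv = 0 := by
      ext j
      rw [h, comp_zero]
    rw [← e.hom_inv_id, this, comp_zero]
  have := hS j
  let i : S j ⟶ X := biproduct.ι S j ≫ e.inv
  let p : X ⟶ S j := e.hom ≫ biproduct.π S j
  have hip : i ≫ p = 𝟙 _ := by simp [i, p]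
  have h1 : Module.finrank k (X ⟶ X) = 1 :=
    le_antisymm h (Module.finrank_pos_iff_exists_ne_zero.2 ⟨_, h0⟩)
  -- The idempotent projecting onto a simple summand must be a scalar, and `i ≫ p = 𝟙 _` forces the
  -- scalar to be 1, so the summand is all of `X`.
  obtain ⟨c, hc⟩ := (finrank_eq_one_iff_of_nonzero' (𝟙 X) h0).1 h1 (p ≫ i)
  have hi : c • i = i := by
    have := congrArg (fun f => i ≫ f) hc
    simpa [reassoc_of% hip] using this
  have hc1 : c = 1 := by
    by_contra hne
    have : (c - 1) • i = 0 := by rw [sub_smul, hi, one_smul, sub_self]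
    exact hj ((smul_eq_zero.1 this).resolve_left (sub_ne_zero.2 hne))
  rw [hc1, one_smul] at hc
  exact Simple.of_iso (⟨p, i, hc.symm, hip⟩ : X ≅ S j)

include k in
lemma exists_iso_biproduct_simple (X : C) :
    ∃ (n : ℕ) (S : Fin n → C), (∀ i, Simple (S i)) ∧ Nonempty (X ≅ ⨁ S) :=
  IsFusion.semisimple (k := k) X

section

variable [IsAlgClosed k]

/-- Objects with the same multiplicities of all simple objects are isomorphic. -/
lemma nonempty_iso_of_homDim_eq {X Y : C} (h : ∀ S : C, Simple S → homDim k S X = homDim k S Y) :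
    Nonempty (X ≅ Y) := by
  classical
  obtain ⟨n, S, hS, ⟨e⟩⟩ := exists_iso_biproduct_simple k X
  obtain ⟨m, T, hT, ⟨e'⟩⟩ := exists_iso_biproduct_simple k Y
  have hcount : ∀ (n : ℕ) (S : Fin n → C), (∀ i, Simple (S i)) → ∀ U : C, Simple U →
      homDim k U (⨁ S) = Fintype.card {i // toSkeleton (S i) = toSkeleton U} := by
    intro n S hS U hU
    rw [homDim_biproduct_right, Fintype.card_subtype, Finset.card_filter]
    refine Finset.sum_congr rfl fun i _ => ?_
    have := hS i
    rw [homDim_simple]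
    refine if_congr ?_ rfl rfl
    rw [toSkeleton_eq_toSkeleton_iff]
    exact ⟨fun ⟨e⟩ => ⟨e.symm⟩, fun ⟨e⟩ => ⟨e.symm⟩⟩
  have key : ∀ c, Nonempty ({i // toSkeleton (S i) = c} ≃ {j // toSkeleton (T j) = c}) := by
    intro c
    by_cases hc : ∃ U : C, Simple U ∧ toSkeleton U = c
    · obtain ⟨U, hU, rfl⟩ := hc
      rw [← Fintype.card_eq, ← hcount n S hS U hU, ← hcount m T hT U hU,
        ← homDim_congr k (Iso.refl U) e, ← homDim_congr k (Iso.refl U) e', h U hU]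
    · have : IsEmpty {i // toSkeleton (S i) = c} := ⟨fun i => hc ⟨_, hS i, i.2⟩⟩
      have : IsEmpty {i // toSkeleton (T i) = c} := ⟨fun i => hc ⟨_, hT i, i.2⟩⟩
      exact ⟨Equiv.equivOfIsEmpty _ _⟩
  -- Multiplicities count the summands in each isomorphism class; gluing the bijections class by
  -- class pairs isomorphic summands.
  let σ : Fin n ≃ Fin m := Equiv.ofFiberEquiv
    (f := fun i => toSkeleton (S i)) (g := fun j => toSkeleton (T j)) fun c => (key c).some
  have hσ : ∀ i, toSkeleton (T (σ i)) = toSkeleton (S i) := fun i =>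
    Equiv.ofFiberEquiv_map (f := fun i => toSkeleton (S i)) (g := fun j => toSkeleton (T j)) _ i
  exact ⟨e ≪≫
    biproduct.whiskerEquiv σ (fun i => (toSkeleton_eq_toSkeleton_iff.1 (hσ i)).some) ≪≫ e'.symm⟩

end

lemma isZero_of_homDim {X : C} (h : ∀ S : C, Simple S → homDim k S X = 0) : IsZero X := by
  by_contra hX
  obtain ⟨S, hS, f, hf⟩ := exists_simple_hom_ne_zero k hX
  exact homDim_ne_zero k hf (h S hS)

-- An epimorphism onto a simple object is nonzero, hence an isomorphism, on some simple summand of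
-- its source, and so it splits. Lifting against arbitrary epimorphisms reduces to this by pullback.
include k in
lemma projective_of_isFusion (X : C) : Projective X := by
  have simple_case : ∀ S : C, Simple S → Projective S := by
    intro S hS
    have split : ∀ (Y : C) (p : Y ⟶ S), Epi p → ∃ s : S ⟶ Y, s ≫ p = 𝟙 S := by
      intro Y p hp
      obtain ⟨n, T, hT, ⟨e⟩⟩ := exists_iso_biproduct_simple k Y
      obtain ⟨j, hj⟩ : ∃ j, biproduct.ι T j ≫ e.inv ≫ p ≠ 0 := by
        by_contra! h
        have h1 : e.inv ≫ p = 0 := by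
          ext j
          rw [h, comp_zero]
        have h2 : p = 0 := by rw [← e.hom_inv_id_assoc p, h1, comp_zero]
        exact id_nonzero S ((cancel_epi p).1 (by rw [h2, zero_comp, zero_comp]))
      have := hT j
      have := isIso_of_hom_simple hj
      exact ⟨inv (biproduct.ι T j ≫ e.inv ≫ p) ≫ biproduct.ι T j ≫ e.inv, by simp⟩
    constructor
    intro E X f p hp
    obtain ⟨s, hs⟩ := split _ (pullback.fst f p) inferInstance
    exact ⟨s ≫ pullback.snd f p, by
      rw [Category.assoc, ← pullback.condition, reassoc_of% hs]⟩
  obtain ⟨n, S, hS, ⟨e⟩⟩ := exists_iso_biproduct_simple k X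
  have := fun j => simple_case _ (hS j)
  have : Projective (⨁ S) := ⟨fun {E Y} f p _ => ⟨biproduct.desc fun j =>
    Projective.factorThru (biproduct.ι S j ≫ f) p, by ext; simp⟩⟩
  exact Projective.of_iso e.symm inferInstance

include k in
/-- Short exact sequences split. -/
lemma iso_biprod_of_shortExact {S : ShortComplex C} (hS : S.ShortExact) :
    Nonempty (S.X₂ ≅ S.X₁ ⊞ S.X₃) := by
  have := projective_of_isFusion k S.X₃
  have s := hS.splittingOfProjective
  exact ⟨s.isoBinaryBiproduct⟩

end Semisimple

end Dimensions

/-! ### One-dimensional objects of `Vec_G^ω` -/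

namespace VecG

section Line

variable {k : Type u'} [Field k] {G : Type w'} [Group G] {ω : Cocycle3 G k}

/-- The line `k` in degree `a`. -/
def line (ω : Cocycle3 G k) (a : G) : VecG k ω where
  carrier := k
  grading g :=
    { carrier := {x | g ≠ a → x = 0}
      zero_mem' := fun _ => rfl
      add_mem' := fun hx hy hg => by rw [hx hg, hy hg, add_zero]
      smul_mem' := fun c x hx hg => by rw [hx hg, smul_zero] }
  independent := by
    classical
    refine iSupIndep_of_proj _ (fun g => if g = a then LinearMap.id else 0) ?_ ?_
    · intro g x hx
      by_cases h : g = a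
      · simp [h]
      · simp [hx h]
    · intro g h hne x hx
      by_cases h1 : g = a
      · rw [hx (fun e => hne (e.trans h1.symm)), map_zero]
      · simp [h1]
  iSup_eq_top := by
    rw [eq_top_iff]
    exact fun x _ => Submodule.mem_iSup_of_mem a (fun h => absurd rfl h)

lemma line_mem (a : G) (x : (line ω a).carrier) : x ∈ (line ω a).grading a :=
  fun h => absurd rfl h

lemma line_eq_zero {a g : G} {x : (line ω a).carrier} (hx : x ∈ (line ω a).grading g)
    (h : g ≠ a) : x = 0 := hx h

/-- The linear map from a line determined by a vector. -/
noncomputable def lineLin (a : G) (V : VecG k ω) (x : V.carrier) :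
    (line ω a).carrier →ₗ[k] V.carrier :=
  LinearMap.toSpanSingleton k V.carrier x

/-- The morphism from a line determined by a homogeneous element. -/
noncomputable def lineHom (V : VecG k ω) {a : G} (x : V.carrier) (hx : x ∈ V.grading a) :
    line ω a ⟶ V :=
  mkHom (lineLin a V x) fun g c hc => by
    by_cases h : g = a
    · subst h
      exact Submodule.smul_mem _ _ hx
    · rw [line_eq_zero hc h, map_zero]
      exact Submodule.zero_mem _

lemma lineHom_ne_zero {V : VecG k ω} {a : G} {x : V.carrier} (hx : x ∈ V.grading a)
    (h : x ≠ 0) : lineHom V x hx ≠ 0 := by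
  intro h0
  have h1 : lin (lineHom V x hx) (1 : k) = 0 := by
    rw [h0]; rfl
  refine h ?_
  rw [← one_smul k x]
  exact h1

lemma exists_lineHom_ne_zero {V : VecG k ω} (hV : ¬ IsZero V) :
    ∃ (a : G) (f : line ω a ⟶ V), f ≠ 0 := by
  by_contra! h
  refine hV ((IsZero.iff_id_eq_zero V).2 (hom_ext (lin_ext fun g x hx => ?_)))
  have hx0 : x = 0 := by
    by_contra hx0
    exact lineHom_ne_zero hx hx0 (h g _)
  rw [hx0, map_zero, map_zero]

lemma isEmpty_line_iso {a b : G} (h : a ≠ b) : IsEmpty (line ω a ≅ line ω b) := by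
  refine ⟨fun e => ?_⟩
  have h0 : lin e.hom (1 : k) = 0 := line_eq_zero (lin_mem e.hom (line_mem a _)) h
  have h1 : lin e.inv (lin e.hom (1 : k)) = (1 : k) :=
    LinearMap.congr_fun (congrArg lin e.hom_inv_id) (1 : k)
  rw [h0, map_zero] at h1
  exact zero_ne_one (α := k) h1

/-- The line in degree `1` is the unit object. -/
def lineOneIso : line ω 1 ≅ unit ω where
  hom := mkHom LinearMap.id fun _ _ hx => hx
  inv := mkHom LinearMap.id fun _ _ hx => hx
  hom_inv_id := rfl
  inv_hom_id := rfl

variable [Fintype G]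

/-- Multiplication, as a linear equivalence from the tensor product of two lines. -/
noncomputable def lineTensorEquiv (a b : G) :
    (tensor (line ω a) (line ω b)).carrier ≃ₗ[k] (line ω (a * b)).carrier :=
  TensorProduct.lid k k

/-- The tensor product of two lines is a line. -/
noncomputable def lineTensorIso (a b : G) : tensor (line ω a) (line ω b) ≅ line ω (a * b) where
  hom := mkHom (lineTensorEquiv (ω := ω) a b).toLinearMap fun _ => tm_mem_of fun a' b' h x hx y hy => by
    by_cases ha : a' = a
    · by_cases hb : b' = b
      · subst ha hb h
        exact line_mem _ _
      · rw [line_eq_zero hy hb, tm_zero, map_zero]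
        exact Submodule.zero_mem _
    · rw [line_eq_zero hx ha, zero_tm, map_zero]
      exact Submodule.zero_mem _
  inv := mkHom (lineTensorEquiv (ω := ω) a b).symm.toLinearMap fun g x hx => by
    by_cases h : g = a * b
    · subst h
      exact tm_mem (V := line ω a) (W := line ω b) (x := (1 : k)) (y := x)
        (line_mem a _) (line_mem b _)
    · rw [line_eq_zero hx h, map_zero]
      exact Submodule.zero_mem _
  hom_inv_id := hom_ext <| LinearMap.ext fun x => (lineTensorEquiv (ω := ω) a b).symm_apply_apply x
  inv_hom_id := hom_ext <| LinearMap.ext fun x => (lineTensorEquiv (ω := ω) a b).apply_symm_apply x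

/-- For an object isomorphic to a line, the two ways to contract a triple tensor product by
a pairing differ by the value of the cocycle. -/
lemma whiskerRight_pairing {V : VecG k ω} {a : G} (e : line ω a ≅ V) (m : V ⊗ V ⟶ 𝟙_ _) :
    (ω.toFun a a a : k) • (m ▷ V ≫ (λ_ V).hom) = (α_ V V V).hom ≫ V ◁ m ≫ (ρ_ V).hom := by
  have hex : ∀ x : V.carrier, ∃ r : k, x = r • lin e.hom (1 : k) := fun x => by
    refine ⟨lin e.inv x, ?_⟩
    have h : lin e.hom (lin e.inv x) = x := LinearMap.congr_fun (congrArg lin e.inv_hom_id) x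
    have h' : ∀ c : k, lin e.hom (c • (show (line ω a).carrier from (1 : k))) =
      c • lin e.hom (1 : k) := fun c => map_smul _ _ _
    refine h.symm.trans (Eq.trans ?_ (h' _))
    exact congrArg _ (mul_one (show k from lin e.inv x)).symm
  have hmem : ∀ x : V.carrier, x ∈ V.grading a := fun x => by
    have h : lin e.hom (lin e.inv x) = x := LinearMap.congr_fun (congrArg lin e.inv_hom_id) x
    rw [← h]
    exact lin_mem _ (line_mem _ _)
  refine hom_ext (tm_ext₃ fun _ _ _ x _ y _ z _ => ?_)
  have hl : lin ((ω.toFun a a a : k) • (m ▷ V ≫ (λ_ V).hom)) (tm (tm x y) z) =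
      (ω.toFun a a a : k) • ((show k from lin m (tm x y)) • z) := rfl
  have hr : lin ((α_ V V V).hom ≫ V ◁ m ≫ (ρ_ V).hom) (tm (tm x y) z) =
      (ω.toFun a a a : k) • ((show k from lin m (tm y z)) • x) := by
    have := assoc_hom_tm (hmem x) (hmem y) (hmem z)
    rw [lin_comp, LinearMap.comp_apply]
    refine (congrArg _ this).trans ?_
    rw [map_smul]
    rfl
  rw [hl, hr]
  congr 1
  -- With the cocycle factored out, `m(x, y) z` and `m(y, z) x` remain to be compared. They agree
  -- because all three vectors are multiples of one vector.
  obtain ⟨r, rfl⟩ := hex x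
  obtain ⟨s, rfl⟩ := hex y
  obtain ⟨t, rfl⟩ := hex z
  have hm : ∀ p q : k, (show k from lin m (tm (p • lin e.hom (1 : k)) (q • lin e.hom (1 : k)))) =
      p * q * (show k from lin m (tm (lin e.hom (1 : k)) (lin e.hom (1 : k)))) := fun p q => by
    rw [smul_tm, tm_smul, map_smul, map_smul, mul_assoc]
    rfl
  rw [hm, hm, smul_smul, smul_smul]
  congr 1
  ring

end Line

end VecG

/-! ### Contractions under a monoidal functor -/

section Transport

open Functor.LaxMonoidal Functor.OplaxMonoidal

variable {D : Type*} [Category* D] [MonoidalCategory D] {E : Type*} [Category* E]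
  [MonoidalCategory E]

/-- Both this contraction and the next factor through the same isomorphism built from `μ`, so it can
be cancelled when a relation between them is pulled back along `F`. -/
lemma map_whiskerRight_pairing (F : D ⥤ E) [F.Monoidal] {V : D} (m : V ⊗ V ⟶ 𝟙_ D) :
    (μ F V V ≫ F.map m ≫ η F) ▷ F.obj V ≫ (λ_ (F.obj V)).hom =
      μ F V V ▷ F.obj V ≫ μ F (V ⊗ V) V ≫ F.map (m ▷ V ≫ (λ_ V).hom) := by
  simp

lemma map_whiskerLeft_pairing (F : D ⥤ E) [F.Monoidal] {V : D} (m : V ⊗ V ⟶ 𝟙_ D) :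
    (α_ _ _ _).hom ≫ F.obj V ◁ (μ F V V ≫ F.map m ≫ η F) ≫ (ρ_ (F.obj V)).hom =
      μ F V V ▷ F.obj V ≫ μ F (V ⊗ V) V ≫ F.map ((α_ _ _ _).hom ≫ V ◁ m ≫ (ρ_ V).hom) := by
  simp

end Transport

/-! ### Tensoring with objects that have an inverse -/

section Invertible

variable (k : Type u') [Field k] {C : Type w'} [Category.{v'} C] [Abelian C] [Linear k C]
  [MonoidalCategory C] [MonoidalPreadditive C] [MonoidalLinear k C] [RigidCategory C]
  [IsFusion k C]

omit [Abelian C] [Linear k C] [MonoidalPreadditive C] [MonoidalLinear k C] [RigidCategory C]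
  [IsFusion k C] in
lemma whiskerLeft_injective_of_iso {X Y : C} (e : Y ⊗ X ≅ 𝟙_ C) {Z W : C} {f g : Z ⟶ W}
    (h : X ◁ f = X ◁ g) : f = g := by
  have h1 : (Y ⊗ X) ◁ f = (Y ⊗ X) ◁ g := by
    simp only [tensor_whiskerLeft, h]
  have h2 : 𝟙_ C ◁ f = 𝟙_ C ◁ g := by
    rw [← cancel_epi (e.hom ▷ Z), ← whisker_exchange, ← whisker_exchange, h1]
  simpa using h2

lemma homDim_le_tensorLeft {X Y : C} (e : Y ⊗ X ≅ 𝟙_ C) (Z W : C) :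
    homDim k Z W ≤ homDim k (X ⊗ Z) (X ⊗ W) := by
  let L : (Z ⟶ W) →ₗ[k] (X ⊗ Z ⟶ X ⊗ W) :=
    { toFun := fun f => X ◁ f
      map_add' := fun f g => by simp
      map_smul' := fun c f => by simp }
  exact LinearMap.finrank_le_finrank_of_injective (f := L)
    fun f g h => whiskerLeft_injective_of_iso e h

include k in
lemma not_isZero_tensorUnit : ¬ IsZero (𝟙_ C) :=
  have := simple_tensorUnit k C
  Simple.not_isZero _

omit [RigidCategory C] [IsFusion k C] [Linear k C] [MonoidalLinear k C] in
lemma isZero_tensor_right (X : C) {Y : C} (h : IsZero Y) : IsZero (X ⊗ Y) := by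
  rw [IsZero.iff_id_eq_zero] at h ⊢
  rw [← MonoidalCategory.whiskerLeft_id, h, MonoidalPreadditive.whiskerLeft_zero]

variable [IsAlgClosed k]

include k in
/-- Tensoring with an invertible object preserves simple objects. -/
lemma simple_tensor_of_iso {X Y : C} (e : Y ⊗ X ≅ 𝟙_ C) (e' : X ⊗ Y ≅ 𝟙_ C) (Z : C) [Simple Z] :
    Simple (X ⊗ Z) := by
  have e'' : Y ⊗ X ⊗ Z ≅ Z := (α_ _ _ _).symm ≪≫ whiskerRightIso e Z ≪≫ λ_ Z
  refine simple_of_homDim_self k (fun h => Simple.not_isZero Z ?_) ?_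
  · exact (isZero_tensor_right Y h).of_iso e''.symm
  · refine (homDim_le_tensorLeft k e' _ _).trans ?_
    rw [homDim_congr k e'' e'', homDim_self_simple]

end Invertible

/-! ### The nontrivial simple object of the trivial component -/

namespace Grading

/-- A nontrivial simple object of order two which, together with the unit object, detects the
nonzero objects of the trivial component. -/
structure IsSign {C : Type w'} [Category.{v'} C] [Abelian C] [MonoidalCategory C]
    {G : Type*} [Group G] [Finite G] (Γ : Grading C G) (δ : C) : Prop where
  mem : Γ.component 1 δ
  simple : Simple δ
  isEmpty_iso : IsEmpty (𝟙_ C ≅ δ)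
  sq : Nonempty (δ ⊗ δ ≅ 𝟙_ C)
  detect : ∀ Z : C, Γ.component 1 Z → ¬ IsZero Z → (∃ f : 𝟙_ C ⟶ Z, f ≠ 0) ∨ ∃ f : δ ⟶ Z, f ≠ 0

variable {k : Type u'} [Field k] {C : Type w'} [Category.{v'} C] [Abelian C] [Linear k C]
  [MonoidalCategory C] [MonoidalPreadditive C] [MonoidalLinear k C] [RigidCategory C]
  [IsFusion k C] [IsAlgClosed k]
  {G : Type*} [Group G] [Finite G]

/-- The object `δ` is the preimage of the line in the nontrivial degree. Besides `IsSign`, the only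
trace of the cocycle kept for the rest of the proof is the scalar comparing the two contractions of
`δ ⊗ δ ⊗ δ`. -/
lemma exists_isSign (Γ : Grading C G) {ω : Cocycle3 (Multiplicative (ZMod 2)) k}
    (hω : TensorEquivalent k (Γ.component 1).FullSubcategory (VecG k ω)) :
    ∃ δ : C, Γ.IsSign δ ∧ ∃ m : δ ⊗ δ ≅ 𝟙_ C,
      (ω.toFun (.ofAdd 1) (.ofAdd 1) (.ofAdd 1) : k) • (m.hom ▷ δ ≫ (λ_ δ).hom) =
        (α_ δ δ δ).hom ≫ δ ◁ m.hom ≫ (ρ_ δ).hom := by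
  obtain ⟨F, hF, hFa, hFl, ⟨hFm⟩⟩ := hω
  let a : Multiplicative (ZMod 2) := .ofAdd 1
  have ha : a ≠ 1 := by decide
  have haa : a * a = 1 := by decide
  let d := F.objPreimage (VecG.line ω a)
  let e : VecG.line ω a ≅ F.obj d := (F.objObjPreimageIso _).symm
  let u : VecG.line ω 1 ≅ F.obj (𝟙_ _) := VecG.lineOneIso ≪≫ Functor.Monoidal.εIso F
  let m₀ : F.obj (d ⊗ d) ≅ F.obj (𝟙_ _) :=
    (Functor.Monoidal.μIso F d d).symm ≪≫ (e.symm ⊗ᵢ e.symm) ≪≫ VecG.lineTensorIso a a ≪≫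
      eqToIso (by rw [haa]) ≪≫ u
  let m : d ⊗ d ≅ 𝟙_ _ := F.preimageIso m₀
  have hm := VecG.whiskerRight_pairing e
    (Functor.LaxMonoidal.μ F d d ≫ F.map m.hom ≫ Functor.OplaxMonoidal.η F)
  rw [map_whiskerRight_pairing, map_whiskerLeft_pairing, ← Linear.comp_smul, ← Linear.comp_smul,
    cancel_epi, cancel_epi, ← F.map_smul] at hm
  have hm' := F.map_injective hm
  let M : d.obj ⊗ d.obj ≅ 𝟙_ C := (Γ.component 1).ι.mapIso m
  refine ⟨d.obj, ⟨d.property, ?_, ⟨fun f => ?_⟩, ⟨M⟩,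
    fun Z hZ hZ0 => ?_⟩, M, congrArg (fun f => f.hom) hm'⟩
  · have := simple_tensorUnit k C
    have := simple_tensor_of_iso k M M (𝟙_ C)
    exact Simple.of_iso (ρ_ d.obj).symm
  · have f' : 𝟙_ (Γ.component 1).FullSubcategory ≅ d := (Γ.component 1).isoMk f
    exact (VecG.isEmpty_line_iso (ω := ω) ha).false (e ≪≫ F.mapIso f'.symm ≪≫ u.symm)
  · let Z' : (Γ.component 1).FullSubcategory := ⟨Z, hZ⟩
    have hFZ : ¬ IsZero (F.obj Z') := fun h => hZ0 <| by
      have h1 : 𝟙 Z' = 0 := F.map_injective (h.eq_of_src _ _)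
      rw [IsZero.iff_id_eq_zero]
      exact congrArg (fun f => f.hom) h1
    -- A nonzero graded space has a nonzero homogeneous vector. Its degree decides whether the unit
    -- or `δ` maps to `Z`.
    obtain ⟨g, f, hf⟩ := VecG.exists_lineHom_ne_zero hFZ
    have pull : ∀ (W : (Γ.component 1).FullSubcategory) (i : VecG.line ω g ≅ F.obj W),
        ∃ f : W.obj ⟶ Z, f ≠ 0 := fun W i => by
      refine ⟨(F.preimage (Y := Z') (i.inv ≫ f)).hom, fun h => hf ?_⟩
      have h1 : F.preimage (Y := Z') (i.inv ≫ f) = 0 := ObjectProperty.hom_ext _ h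
      have h2 : i.inv ≫ f = 0 := by rw [← F.map_preimage (Y := Z') (i.inv ≫ f), h1, F.map_zero]
      rw [← cancel_epi i.inv, h2, comp_zero]
    have h2 : ∀ g : Multiplicative (ZMod 2), g = 1 ∨ g = .ofAdd 1 := by decide
    rcases h2 g with rfl | rfl
    · exact Or.inl (pull _ u)
    · exact Or.inr (pull _ e)

end Grading

/-! ### Nonvanishing of tensor products and symmetry of multiplicities -/

section

variable (k : Type u') [Field k] {C : Type w'} [Category.{v'} C] [Abelian C] [Linear k C]
  [MonoidalCategory C] [MonoidalPreadditive C] [MonoidalLinear k C] [RigidCategory C]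
  [IsFusion k C]

include k in
/-- The tensor product of nonzero objects is nonzero. -/
lemma not_isZero_tensor {X Y : C} (hX : ¬ IsZero X) (hY : ¬ IsZero Y) : ¬ IsZero (X ⊗ Y) := by
  intro h
  have := simple_tensorUnit k C
  have hev : ε_ X Xᘁ ≠ 0 := fun h0 => hX <| by
    have h1 := ExactPairing.evaluation_coevaluation X Xᘁ
    rw [h0, MonoidalPreadditive.whiskerLeft_zero, comp_zero, comp_zero] at h1
    rw [IsZero.iff_id_eq_zero, ← (λ_ X).inv_hom_id, ← Category.comp_id (λ_ X).hom,
      ← (ρ_ X).inv_hom_id, ← Category.assoc (λ_ X).hom, ← h1, zero_comp, comp_zero]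
  -- The evaluation is a split epimorphism onto the unit, so `Y` is a retract of `(Xᘁ ⊗ X) ⊗ Y`,
  -- which vanishes with `X ⊗ Y`.
  have := epi_of_nonzero_to_simple hev
  have := projective_of_isFusion k (𝟙_ C)
  let s : 𝟙_ C ⟶ Xᘁ ⊗ X := Projective.factorThru (𝟙 _) (ε_ X Xᘁ)
  have hs : s ≫ ε_ X Xᘁ = 𝟙 _ := Projective.factorThru_comp _ _
  have h2 : IsZero ((Xᘁ ⊗ X) ⊗ Y) := (isZero_tensor_right Xᘁ h).of_iso (α_ _ _ _)
  refine hY ?_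
  have h3 : 𝟙 (𝟙_ C ⊗ Y) = 0 := by
    rw [← MonoidalCategory.id_whiskerRight, ← hs, MonoidalCategory.comp_whiskerRight,
      h2.eq_of_src (ε_ X Xᘁ ▷ Y) 0, comp_zero]
  exact ((IsZero.iff_id_eq_zero _).2 h3).of_iso (λ_ Y).symm

variable [IsAlgClosed k]

lemma homDim_comm (X Y : C) : homDim k X Y = homDim k Y X := by
  classical
  obtain ⟨n, S, hS, ⟨e⟩⟩ := exists_iso_biproduct_simple k X
  obtain ⟨m, T, hT, ⟨e'⟩⟩ := exists_iso_biproduct_simple k Y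
  rw [homDim_congr k e e', homDim_congr k e' e, homDim_biproduct_left, homDim_biproduct_left]
  simp_rw [homDim_biproduct_right]
  rw [Finset.sum_comm]
  refine Finset.sum_congr rfl fun j _ => Finset.sum_congr rfl fun i _ => ?_
  have := hS i
  have := hT j
  rw [homDim_simple, homDim_simple]
  exact if_congr ⟨fun ⟨e⟩ => ⟨e.symm⟩, fun ⟨e⟩ => ⟨e.symm⟩⟩ rfl rfl

lemma homDim_unit_tensor_dual (X : C) [Simple X] : homDim k (𝟙_ C) (X ⊗ Xᘁ) = 1 := by
  rw [← homDim_tensor_right_adj, homDim_congr k (λ_ X) (Iso.refl X), homDim_self_simple]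

omit [IsAlgClosed k] in
lemma homDim_tensorLeft {X Y : C} (e : Y ⊗ X ≅ 𝟙_ C) (e' : X ⊗ Y ≅ 𝟙_ C) (Z W : C) :
    homDim k (X ⊗ Z) (X ⊗ W) = homDim k Z W := by
  have i : ∀ Z, Y ⊗ X ⊗ Z ≅ Z := fun Z => (α_ _ _ _).symm ≪≫ whiskerRightIso e Z ≪≫ λ_ Z
  refine le_antisymm ((homDim_le_tensorLeft k e' _ _).trans ?_) (homDim_le_tensorLeft k e Z W)
  rw [homDim_congr k (i Z) (i W)]

end

/-! ### Gradings -/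

namespace Grading

section

variable {C : Type w'} [Category.{v'} C] [Abelian C] [MonoidalCategory C]
  {G : Type*} [Group G] [Finite G] (Γ : Grading C G)

/-- An object which receives no nonzero morphism from the other components lies in `C_g`. -/
lemma component_of_forall {g₀ : G} {X : C}
    (h : ∀ g, g ≠ g₀ → ∀ Y : C, Γ.component g Y → ∀ f : Y ⟶ X, f = 0) : Γ.component g₀ X := by
  obtain ⟨F, hF, ⟨e⟩⟩ := Γ.decomposition X
  refine Γ.of_iso g₀ _ _ ⟨biproduct.ι F g₀ ≫ e.inv, e.hom ≫ biproduct.π F g₀, by simp, ?_⟩ (hF g₀)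
  rw [← cancel_epi e.inv]
  ext g
  by_cases hg : g = g₀
  · subst hg
    simp
  · have h0 := h g hg _ (hF g) (biproduct.ι F g ≫ e.inv)
    simp [biproduct.ι_π_ne_assoc _ hg, h0]

lemma eq_of_component {g h : G} {X : C} (hX : ¬ IsZero X) (hg : Γ.component g X)
    (hh : Γ.component h X) : g = h := by
  by_contra hne
  exact hX ((IsZero.iff_id_eq_zero X).2 (Γ.hom_eq_zero g h hne X X hg hh _))

lemma eq_of_hom_ne_zero {g h : G} {X Y : C} (hg : Γ.component g X)
    (hh : Γ.component h Y) {f : X ⟶ Y} (hf : f ≠ 0) : g = h := by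
  by_contra hne
  exact hf (Γ.hom_eq_zero g h hne X Y hg hh _)

/-- Components are closed under direct summands. -/
lemma component_of_retract {g : G} {X Y : C} (hY : Γ.component g Y) (i : X ⟶ Y) (r : Y ⟶ X)
    (h : i ≫ r = 𝟙 X) : Γ.component g X :=
  Γ.component_of_forall fun g' hg' Z hZ f => by
    rw [← Category.comp_id f, ← h, ← Category.assoc,
      Γ.hom_eq_zero g' g hg' _ _ hZ hY (f ≫ i), zero_comp]

lemma component_of_iso_biproduct {g : G} {X : C} (hX : Γ.component g X) {J : Type*} [Finite J]
    {S : J → C} (e : X ≅ ⨁ S) (j : J) : Γ.component g (S j) :=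
  Γ.component_of_retract hX (biproduct.ι S j ≫ e.inv) (e.hom ≫ biproduct.π S j) (by simp)

/-- Simple objects are homogeneous. -/
lemma exists_component (X : C) [Simple X] : ∃ g, Γ.component g X := by
  obtain ⟨F, hF, ⟨e⟩⟩ := Γ.decomposition X
  obtain ⟨g, hg⟩ : ∃ g, biproduct.ι F g ≫ e.inv ≠ 0 := by
    by_contra! h
    have h0 : e.inv = 0 := by
      ext g
      rw [h, comp_zero]
    exact id_nonzero X (by rw [← e.hom_inv_id, h0, comp_zero])
  have : IsSplitMono (biproduct.ι F g ≫ e.inv) := ⟨⟨⟨e.hom ≫ biproduct.π F g, by simp⟩⟩⟩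
  have := isIso_of_mono_of_nonzero hg
  exact ⟨g, Γ.of_iso g _ _ (asIso (biproduct.ι F g ≫ e.inv)) (hF g)⟩

variable [MonoidalPreadditive C]

/-- A morphism `Y ⟶ Xᘁ` corresponds to a morphism `Y ⊗ X ⟶ 𝟙_ C`, which vanishes unless the degrees
of `Y` and `X` multiply to 1. -/
lemma component_rightDual [RigidCategory C] {g : G} {X : C} (hX : Γ.component g X) :
    Γ.component g⁻¹ Xᘁ := by
  refine Γ.component_of_forall fun h hh Y hY f => ?_
  have h0 : (tensorRightHomEquiv Y X Xᘁ (𝟙_ C)).symm (f ≫ (λ_ _).inv) = 0 :=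
    Γ.hom_eq_zero (h * g) 1 (fun e => hh (eq_inv_of_mul_eq_one_left e)) _ _
      (Γ.tensor h g _ _ hY hX) Γ.unit_mem _
  have h1 : f ≫ (λ_ _).inv = 0 := by
    rw [Equiv.symm_apply_eq] at h0
    rw [h0]
    simp [tensorRightHomEquiv]
  rw [← cancel_mono (λ_ Xᘁ).inv, h1, zero_comp]

lemma component_leftDual [RigidCategory C] {g : G} {X : C} (hX : Γ.component g X) :
    Γ.component g⁻¹ (ᘁX) := by
  refine Γ.component_of_forall fun h hh Y hY f => ?_
  have h0 : (tensorLeftHomEquiv Y (ᘁX) X (𝟙_ C)).symm (f ≫ (ρ_ _).inv) = 0 :=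
    Γ.hom_eq_zero (g * h) 1 (fun e => hh (eq_inv_of_mul_eq_one_right e)) _ _
      (Γ.tensor g h _ _ hX hY) Γ.unit_mem _
  have h1 : f ≫ (ρ_ _).inv = 0 := by
    rw [Equiv.symm_apply_eq] at h0
    rw [h0]
    simp [tensorLeftHomEquiv]
  rw [← cancel_mono (ρ_ (ᘁX)).inv, h1, zero_comp]

lemma component_tensor_dual [RigidCategory C] (X : C) [Simple X] :
    Γ.component 1 (X ⊗ Xᘁ) := by
  obtain ⟨g, hg⟩ := Γ.exists_component X
  simpa using Γ.tensor g g⁻¹ _ _ hg (Γ.component_rightDual hg)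

/-- The trivial component is a fusion subcategory. -/
lemma isFusionSubcategory_component_one [RigidCategory C] :
    IsFusionSubcategory (Γ.component 1) where
  unit := Γ.unit_mem
  tensor X Y hX hY := by simpa using Γ.tensor 1 1 X Y hX hY
  zero X hX := Γ.component_of_forall fun _ _ _ _ f => hX.eq_of_tgt f 0
  biprod X Y hX hY := Γ.component_of_forall fun g hg Z hZ f => by
    apply biprod.hom_ext
    · rw [Γ.hom_eq_zero g 1 hg _ _ hZ hX (f ≫ biprod.fst), zero_comp]
    · rw [Γ.hom_eq_zero g 1 hg _ _ hZ hY (f ≫ biprod.snd), zero_comp]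
  summand X Y i r hir hY := Γ.component_of_retract hY i r hir
  rightDual X hX := by simpa using Γ.component_rightDual hX
  leftDual X hX := by simpa using Γ.component_leftDual hX

end

end Grading

/-- `X` absorbs `δ`. -/
def IsFixed {C : Type w'} [Category.{v'} C] [MonoidalCategory C] (δ X : C) : Prop :=
  Nonempty (δ ⊗ X ≅ X)

lemma IsFixed.of_iso {C : Type w'} [Category.{v'} C] [MonoidalCategory C] {δ X Y : C}
    (h : IsFixed δ X) (e : X ≅ Y) : IsFixed δ Y :=
  ⟨whiskerLeftIso δ e.symm ≪≫ h.some ≪≫ e⟩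

/-! ### Simple objects that do or do not absorb the sign object -/

namespace Grading.IsSign

section

variable {C : Type w'} [Category.{v'} C] [Abelian C] [MonoidalCategory C]
  {G : Type*} [Group G] [Finite G] {Γ : Grading C G} {δ : C} (hδ : Γ.IsSign δ)

include hδ

lemma component_tensor {g : G} {X : C} (hX : Γ.component g X) : Γ.component g (δ ⊗ X) := by
  simpa using Γ.tensor 1 g _ _ hδ.mem hX

lemma not_isFixed_unit : ¬ IsFixed δ (𝟙_ C) := fun ⟨e⟩ =>
  hδ.isEmpty_iso.false (e.symm ≪≫ ρ_ δ)

end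

variable (k : Type u') [Field k] {C : Type w'} [Category.{v'} C] [Abelian C] [Linear k C]
  [MonoidalCategory C] [MonoidalPreadditive C] [MonoidalLinear k C] [RigidCategory C]
  [IsFusion k C] [IsAlgClosed k] {G : Type*} [Group G] [Finite G] {Γ : Grading C G} {δ : C}
  (hδ : Γ.IsSign δ)

include k hδ

omit [IsAlgClosed k] in
lemma iso_of_component_one {X : C} [Simple X] (hX : Γ.component 1 X) :
    Nonempty (𝟙_ C ≅ X) ∨ Nonempty (δ ≅ X) := by
  have := simple_tensorUnit k C
  have := hδ.simple
  rcases hδ.detect X hX (Simple.not_isZero X) with ⟨f, hf⟩ | ⟨f, hf⟩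
  · have := isIso_of_hom_simple hf
    exact Or.inl ⟨asIso f⟩
  · have := isIso_of_hom_simple hf
    exact Or.inr ⟨asIso f⟩

/-- Only the unit and `δ` can occur in an object of the trivial component, so two multiplicities
suffice. -/
lemma nonempty_iso_of_homDim {X Y : C} (hX : Γ.component 1 X) (hY : Γ.component 1 Y)
    (h₁ : homDim k (𝟙_ C) X = homDim k (𝟙_ C) Y) (h₂ : homDim k δ X = homDim k δ Y) :
    Nonempty (X ≅ Y) := by
  refine nonempty_iso_of_homDim_eq k fun S hS => ?_
  obtain ⟨g, hg⟩ := Γ.exists_component S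
  by_cases h : g = 1
  · subst h
    rcases hδ.iso_of_component_one k hg with ⟨⟨e⟩⟩ | ⟨⟨e⟩⟩
    · rw [homDim_congr k e.symm (Iso.refl X), homDim_congr k e.symm (Iso.refl Y), h₁]
    · rw [homDim_congr k e.symm (Iso.refl X), homDim_congr k e.symm (Iso.refl Y), h₂]
  · rw [homDim_eq_zero k (Γ.hom_eq_zero g 1 h _ _ hg hX),
      homDim_eq_zero k (Γ.hom_eq_zero g 1 h _ _ hg hY)]

omit [IsAlgClosed k] in
lemma homDim_unit_sign : homDim k (𝟙_ C) δ = 0 :=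
  have := simple_tensorUnit k C
  have := hδ.simple
  homDim_simple_of_isEmpty k hδ.isEmpty_iso

lemma simple_tensor (X : C) [Simple X] : Simple (δ ⊗ X) :=
  have ⟨e⟩ := hδ.sq
  simple_tensor_of_iso k e e X

/-- The simple objects in the component of `X` are `X` and `δ ⊗ X`. -/
lemma iso_of_component {g : G} {X Y : C} [Simple X] [Simple Y] (hX : Γ.component g X)
    (hY : Γ.component g Y) : Nonempty (X ≅ Y) ∨ Nonempty (δ ⊗ X ≅ Y) := by
  have hX0 : ¬ IsZero Xᘁ := fun h => by
    have h1 : homDim k (𝟙_ C ⊗ X) X = homDim k (𝟙_ C) (X ⊗ Xᘁ) :=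
      homDim_tensor_right_adj k _ _ _
    rw [homDim_congr k (λ_ X) (Iso.refl X), homDim_self_simple,
      homDim_of_isZero_right k _ (isZero_tensor_right X h)] at h1
    omega
  have h1 : Γ.component 1 (Y ⊗ Xᘁ) := by
    simpa using Γ.tensor g g⁻¹ _ _ hY (Γ.component_rightDual hX)
  have := hδ.simple_tensor k X
  -- By adjunction, a map to `Y ⊗ Xᘁ` from the unit or from `δ` is a map to `Y` from `X` or from `δ
  -- ⊗ X`.
  rcases hδ.detect _ h1 (not_isZero_tensor k (Simple.not_isZero Y) hX0) with ⟨f, hf⟩ | ⟨f, hf⟩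
  · left
    apply Fusion.nonempty_iso_of_homDim k
    rw [← homDim_congr k (λ_ X) (Iso.refl Y), homDim_tensor_right_adj]
    exact homDim_ne_zero k hf
  · right
    apply Fusion.nonempty_iso_of_homDim k
    rw [homDim_tensor_right_adj]
    exact homDim_ne_zero k hf

lemma isFixed_of_component {g : G} {X Y : C} [Simple X] [Simple Y] (hX : Γ.component g X)
    (hY : Γ.component g Y) (h : IsFixed δ X) : IsFixed δ Y := by
  rcases hδ.iso_of_component k hX hY with ⟨⟨e⟩⟩ | ⟨⟨e⟩⟩
  · exact h.of_iso e
  · exact h.of_iso (h.some.symm ≪≫ e)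

lemma iso_of_isFixed {g : G} {X Y : C} [Simple X] [Simple Y] (hX : Γ.component g X)
    (hY : Γ.component g Y) (h : IsFixed δ X) : Nonempty (X ≅ Y) := by
  rcases hδ.iso_of_component k hX hY with ⟨⟨e⟩⟩ | ⟨⟨e⟩⟩
  · exact ⟨e⟩
  · exact ⟨h.some.symm ≪≫ e⟩

/-- By adjunction the multiplicity of `δ` is `dim Hom(δ ⊗ X, X)`, here zero between nonisomorphic
simples; for a fixed object, in the next lemma, it is one. -/
lemma tensor_dual_of_not_isFixed {X : C} [Simple X] (h : ¬ IsFixed δ X) :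
    Nonempty (X ⊗ Xᘁ ≅ 𝟙_ C) := by
  have := simple_tensorUnit k C
  have := hδ.simple
  have := hδ.simple_tensor k X
  refine hδ.nonempty_iso_of_homDim k (Γ.component_tensor_dual X) Γ.unit_mem ?_ ?_
  · rw [homDim_unit_tensor_dual k, homDim_self_simple]
  · rw [← homDim_tensor_right_adj, homDim_comm k δ, hδ.homDim_unit_sign k]
    exact homDim_simple_of_isEmpty k (not_nonempty_iff.1 h)

lemma tensor_dual_of_isFixed {X : C} [Simple X] (h : IsFixed δ X) :
    Nonempty (X ⊗ Xᘁ ≅ 𝟙_ C ⊞ δ) := by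
  have := simple_tensorUnit k C
  have := hδ.simple
  refine hδ.nonempty_iso_of_homDim k (Γ.component_tensor_dual X)
    (Γ.isFusionSubcategory_component_one.biprod _ _ Γ.unit_mem hδ.mem) ?_ ?_
  · rw [homDim_unit_tensor_dual k, homDim_biprod_right, homDim_self_simple,
      hδ.homDim_unit_sign k]
  · rw [← homDim_tensor_right_adj, homDim_biprod_right, homDim_comm k δ (𝟙_ C),
      hδ.homDim_unit_sign k, homDim_congr k h.some (Iso.refl X), homDim_self_simple,
      homDim_self_simple]

/-- If `X` were fixed with `X ⊗ Xᘁ ≅ 𝟙_ C`, then `Hom(δ ⊗ X, X)` would be one-dimensional while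
`Hom(δ, 𝟙_ C)`, equal to it in dimension, is zero. -/
lemma isInvertible_iff (X : C) [Simple X] : IsInvertible X ↔ ¬ IsFixed δ X := by
  refine ⟨fun ⟨_, ⟨e⟩⟩ h => ?_, fun h => ⟨inferInstance, hδ.tensor_dual_of_not_isFixed k h⟩⟩
  have h1 := homDim_tensor_right_adj k δ X X
  rw [homDim_congr k (Iso.refl δ) e, homDim_comm k δ, hδ.homDim_unit_sign k,
    homDim_congr k h.some (Iso.refl X), homDim_self_simple] at h1
  omega

/-- Invertibility is defined on one side only. The other side follows because `X ⊗ Xᘁ ⊗ X ≅ X` makes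
`Xᘁ ⊗ X` simple, and the adjunction gives it a nonzero map to the unit. -/
lemma dual_tensor_of_not_isFixed {X : C} [Simple X] (h : ¬ IsFixed δ X) :
    Nonempty (Xᘁ ⊗ X ≅ 𝟙_ C) := by
  have := simple_tensorUnit k C
  obtain ⟨e⟩ := hδ.tensor_dual_of_not_isFixed k h
  have h1 : homDim k (Xᘁ ⊗ X) (𝟙_ C) = 1 := by
    rw [homDim_tensor_left_adj, homDim_congr k (Iso.refl X) (ρ_ X), homDim_self_simple]
  have h2 : homDim k (Xᘁ ⊗ X) (Xᘁ ⊗ X) = 1 := by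
    rw [homDim_tensor_left_adj, homDim_congr k (Iso.refl X)
      ((α_ _ _ _).symm ≪≫ whiskerRightIso e X ≪≫ λ_ X), homDim_self_simple]
  have : Simple (Xᘁ ⊗ X) := simple_of_homDim_self k
    (fun h => by rw [homDim_of_isZero_left k h] at h1; omega) h2.le
  exact Fusion.nonempty_iso_of_homDim k (by omega)

lemma simple_tensor_right (X : C) [Simple X] : Simple (X ⊗ δ) := by
  have := hδ.simple
  obtain ⟨e⟩ := hδ.sq
  have i : (X ⊗ δ) ⊗ δ ≅ X := α_ _ _ _ ≪≫ whiskerLeftIso X e ≪≫ ρ_ X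
  have hn : ¬ IsFixed δ δ := fun ⟨f⟩ => hδ.isEmpty_iso.false (e.symm ≪≫ f)
  obtain ⟨e'⟩ := hδ.tensor_dual_of_not_isFixed k hn
  refine simple_of_homDim_self k
    (not_isZero_tensor k (Simple.not_isZero X) (Simple.not_isZero δ)) ?_
  rw [homDim_tensor_right_adj, homDim_congr k (Iso.refl X)
      (α_ _ _ _ ≪≫ whiskerLeftIso X e' ≪≫ ρ_ X), homDim_self_simple]

lemma tensor_comm_of_isFixed {X : C} [Simple X] (h : IsFixed δ X) : Nonempty (X ⊗ δ ≅ X) := by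
  obtain ⟨g, hg⟩ := Γ.exists_component X
  have := hδ.simple_tensor_right k X
  obtain ⟨e⟩ := hδ.iso_of_isFixed k hg (Y := X ⊗ δ) (by simpa using Γ.tensor g 1 _ _ hg hδ.mem) h
  exact ⟨e.symm⟩

/-- Every simple object commutes with `δ`. -/
lemma tensor_comm (X : C) [Simple X] : Nonempty (X ⊗ δ ≅ δ ⊗ X) := by
  by_cases h : IsFixed δ X
  · exact ⟨(hδ.tensor_comm_of_isFixed k h).some ≪≫ h.some.symm⟩
  · obtain ⟨g, hg⟩ := Γ.exists_component X
    have := hδ.simple_tensor_right k X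
    obtain ⟨e⟩ := hδ.dual_tensor_of_not_isFixed k h
    rcases hδ.iso_of_component k hg (Y := X ⊗ δ) (by simpa using Γ.tensor g 1 _ _ hg hδ.mem)
      with ⟨⟨f⟩⟩ | ⟨⟨f⟩⟩
    -- The case `X ⊗ δ ≅ X` cannot occur: it would put `δ` inside `Xᘁ ⊗ X`, which is the unit.
    · have h1 : homDim k (Xᘁ ⊗ X) δ = homDim k X (X ⊗ δ) := homDim_tensor_left_adj k _ _ _
      rw [homDim_congr k e (Iso.refl δ), hδ.homDim_unit_sign k,
        homDim_congr k (Iso.refl X) f.symm, homDim_self_simple] at h1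
      omega
    · exact ⟨f.symm⟩

/-! ### Products of simple objects -/

lemma simple_tensor_of_not_isFixed_left {X : C} (Y : C) [Simple X] [Simple Y]
    (h : ¬ IsFixed δ X) : Simple (X ⊗ Y) :=
  simple_tensor_of_iso k (hδ.dual_tensor_of_not_isFixed k h).some
    (hδ.tensor_dual_of_not_isFixed k h).some Y

lemma simple_tensor_of_not_isFixed_right (X : C) {Y : C} [Simple X] [Simple Y]
    (h : ¬ IsFixed δ Y) : Simple (X ⊗ Y) := by
  obtain ⟨e⟩ := hδ.tensor_dual_of_not_isFixed k h
  refine simple_of_homDim_self k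
    (not_isZero_tensor k (Simple.not_isZero X) (Simple.not_isZero Y)) ?_
  rw [homDim_tensor_right_adj, homDim_congr k (Iso.refl X)
      (α_ _ _ _ ≪≫ whiskerLeftIso X e ≪≫ ρ_ X), homDim_self_simple]

omit [Abelian C] [Linear k C] [MonoidalPreadditive C] [MonoidalLinear k C] [RigidCategory C]
  [IsFusion k C] [IsAlgClosed k] k hδ in
lemma _root_.Fusion.IsFixed.tensor_right {X : C} (h : IsFixed δ X) (Y : C) : IsFixed δ (X ⊗ Y) :=
  ⟨(α_ _ _ _).symm ≪≫ whiskerRightIso h.some Y⟩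

/-- Here `δ` must be moved past `X` before `Y` can absorb it, which is what `tensor_comm` is for. -/
lemma isFixed_tensor_left (X : C) {Y : C} [Simple X] (h : IsFixed δ Y) : IsFixed δ (X ⊗ Y) :=
  ⟨(α_ _ _ _).symm ≪≫ whiskerRightIso (hδ.tensor_comm k X).some.symm Y ≪≫ α_ _ _ _ ≪≫
    whiskerLeftIso X h.some⟩

lemma not_isFixed_tensor {X Y : C} [Simple X] [Simple Y] (hX : ¬ IsFixed δ X)
    (hY : ¬ IsFixed δ Y) : ¬ IsFixed δ (X ⊗ Y) := fun h => by
  obtain ⟨e⟩ := hδ.tensor_dual_of_not_isFixed k hY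
  exact hX ((h.tensor_right Yᘁ).of_iso (α_ _ _ _ ≪≫ whiskerLeftIso X e ≪≫ ρ_ X))

/-- The product of two simple objects which absorb `δ` is the sum of two simple objects which
do not. -/
lemma exists_iso_biproduct_of_isFixed {X Y : C} [Simple X] [Simple Y] (hX : IsFixed δ X)
    (hY : IsFixed δ Y) : ∃ S : Fin 2 → C, (∀ i, Simple (S i) ∧ ¬ IsFixed δ (S i)) ∧
      Nonempty (X ⊗ Y ≅ ⨁ S) := by
  obtain ⟨g, hg⟩ := Γ.exists_component X
  obtain ⟨h, hh⟩ := Γ.exists_component Y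
  have hW : Γ.component (g * h) (X ⊗ Y) := Γ.tensor g h _ _ hg hh
  have hWfix : IsFixed δ (X ⊗ Y) := hX.tensor_right Y
  -- Two adjunctions turn the endomorphisms into `Hom(Xᘁ ⊗ X, Y ⊗ Yᘁ)`. Since `Y ⊗ Yᘁ ≅ 𝟙_ C ⊞ δ`,
  -- this splits into `Hom(X, X)` and `Hom(X, X ⊗ δ)`, each one-dimensional.
  have hend : homDim k (X ⊗ Y) (X ⊗ Y) = 2 := by
    obtain ⟨e⟩ := hδ.tensor_dual_of_isFixed k hY
    rw [homDim_tensor_right_adj, homDim_congr k (Iso.refl X) (α_ _ _ _),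
      ← homDim_tensor_left_adj, homDim_congr k (Iso.refl _) e, homDim_biprod_right,
      homDim_tensor_left_adj, homDim_tensor_left_adj, homDim_congr k (Iso.refl X) (ρ_ X),
      homDim_congr k (Iso.refl X) (hδ.tensor_comm_of_isFixed k hX).some, homDim_self_simple]
  obtain ⟨n, S, hS, ⟨e⟩⟩ := exists_iso_biproduct_simple k (X ⊗ Y)
  have hSg : ∀ i, Γ.component (g * h) (S i) := Γ.component_of_iso_biproduct hW e
  have key : n = 2 ∧ ∀ i, ¬ IsFixed δ (S i) := by
    have hn : n ≠ 0 := by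
      rintro rfl
      rw [homDim_congr k e (Iso.refl _), homDim_biproduct_left] at hend
      simp at hend
    let i₀ : Fin n := ⟨0, Nat.pos_of_ne_zero hn⟩
    let Z := S i₀
    have hZ : Simple Z := hS i₀
    -- Every summand is `Z` or `δ ⊗ Z`, and `X ⊗ Y` absorbs `δ`, so all multiplicities agree; hence
    -- the number of summands times the multiplicity is 2.
    have hcount : ∀ i, homDim k (S i) (X ⊗ Y) = homDim k Z (X ⊗ Y) := fun i => by
      have := hS i
      rcases hδ.iso_of_component k (hSg i₀) (hSg i) with ⟨⟨f⟩⟩ | ⟨⟨f⟩⟩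
      · exact homDim_congr k f.symm (Iso.refl _)
      · rw [homDim_congr k f.symm hWfix.some.symm, homDim_tensorLeft k hδ.sq.some hδ.sq.some]
    have hprod : n * homDim k Z (X ⊗ Y) = 2 := by
      rw [← hend, homDim_congr k e (Iso.refl (X ⊗ Y)), homDim_biproduct_left]
      simp [hcount]
    -- If `Z` were fixed, all summands would be isomorphic to it, giving `n * n = 2`.
    have hZfix : ¬ IsFixed δ Z := fun hZfix => by
      have h1 : homDim k Z (X ⊗ Y) = n := by
        rw [homDim_congr k (Iso.refl Z) e, homDim_biproduct_right]
        have : ∀ i, homDim k Z (S i) = 1 := fun i => by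
          have := hS i
          rw [homDim_congr k (Iso.refl Z) (hδ.iso_of_isFixed k (hSg i₀) (hSg i) hZfix).some.symm,
            homDim_self_simple]
        simp [this]
      rw [h1] at hprod
      have : n < 2 := by nlinarith
      rw [show n = 1 by omega] at hprod
      omega
    -- A single summand would be isomorphic to `X ⊗ Y`, hence fixed.
    have hn1 : n ≠ 1 := fun h1 => by
      let _ : Unique (Fin n) := Unique.mk ⟨i₀⟩ fun i => Fin.ext (by omega)
      exact hZfix (hWfix.of_iso (e ≪≫ biproductUniqueIso S))
    have hn2 : n = 2 := by
      have : n ∣ 2 := ⟨_, hprod.symm⟩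
      have := Nat.le_of_dvd (by norm_num) this
      omega
    refine ⟨hn2, fun i hi => hZfix ?_⟩
    have := hS i
    exact hδ.isFixed_of_component k (hSg i) (hSg i₀) hi
  obtain ⟨rfl, hfix⟩ := key
  exact ⟨S, fun i => ⟨hS i, hfix i⟩, ⟨e⟩⟩

omit hδ [Group G] [Finite G] in
/-- If some object absorbs `δ`, then the associator of `δ` is trivial. -/
lemma _root_.Fusion.IsFixed.pairing_scalar_eq_one {X : C} [Simple X] (hX : IsFixed δ X) (m : δ ⊗ δ ≅ 𝟙_ C) {c : k}
    (hm : c • (m.hom ▷ δ ≫ (λ_ δ).hom) = (α_ δ δ δ).hom ≫ δ ◁ m.hom ≫ (ρ_ δ).hom) : c = 1 := by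
  obtain ⟨f⟩ := hX
  let A : (δ ⊗ δ) ⊗ X ≅ X := whiskerRightIso m X ≪≫ λ_ X
  let B : (δ ⊗ δ) ⊗ X ≅ X := α_ _ _ _ ≪≫ whiskerLeftIso δ f ≪≫ f
  -- By Schur's lemma, acting twice through `f` is a nonzero multiple `s` of contracting `δ ⊗ δ` by
  -- `m`.
  obtain ⟨s, hs⟩ : ∃ s : k, s • 𝟙 X = A.inv ≫ B.hom := endomorphism_simple_eq_smul_id k _
  have hsB : B.hom = s • A.hom := by
    rw [← cancel_epi A.inv, ← hs, Linear.comp_smul, A.inv_hom_id]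
  have hs0 : s ≠ 0 := fun h0 => by
    rw [h0, zero_smul] at hsB
    exact id_nonzero X (by rw [← B.inv_hom_id, hsB, comp_zero])
  have hB : (α_ δ δ X).hom ≫ δ ◁ f.hom ≫ f.hom = s • (m.hom ▷ X ≫ (λ_ X).hom) := hsB
  have hB' : δ ◁ f.hom ≫ f.hom = s • ((α_ δ δ X).inv ≫ m.hom ▷ X ≫ (λ_ X).hom) := by
    rw [← Linear.comp_smul, ← hB, Iso.inv_hom_id_assoc]
  -- The triple action is evaluated in two ways: here the two outer copies of `δ` are contracted, in
  -- `h2` the two inner ones. Both give the factor `s`, so the discrepancy `c` between the two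
  -- contractions must be 1.
  have h1 : ((δ ⊗ δ) ◁ f.hom) ≫ (α_ δ δ X).hom ≫ δ ◁ f.hom ≫ f.hom =
      s • ((α_ (δ ⊗ δ) δ X).inv ≫ (m.hom ▷ δ ≫ (λ_ δ).hom) ▷ X ≫ f.hom) := by
    rw [hB, Linear.comp_smul, whisker_exchange_assoc, leftUnitor_naturality]
    congr 1
    simp
  have h2 : ((δ ⊗ δ) ◁ f.hom) ≫ (α_ δ δ X).hom ≫ δ ◁ f.hom ≫ f.hom =
      s • ((α_ (δ ⊗ δ) δ X).inv ≫
        ((α_ δ δ δ).hom ≫ δ ◁ m.hom ≫ (ρ_ δ).hom) ▷ X ≫ f.hom) := by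
    have : (δ ⊗ δ) ◁ f.hom ≫ (α_ δ δ X).hom ≫ δ ◁ f.hom =
        (α_ δ δ (δ ⊗ X)).hom ≫ δ ◁ (δ ◁ f.hom ≫ f.hom) := by simp
    rw [reassoc_of% this, hB', MonoidalLinear.whiskerLeft_smul, Linear.smul_comp,
      Linear.comp_smul]
    congr 1
    simp
  rw [h1, ← hm, MonoidalLinear.smul_whiskerRight, Linear.smul_comp, Linear.comp_smul] at h2
  have h3 : (α_ (δ ⊗ δ) δ X).inv ≫ (m.hom ▷ δ ≫ (λ_ δ).hom) ▷ X ≫ f.hom ≠ 0 := fun h0 => by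
    refine id_nonzero X ?_
    let I := (α_ (δ ⊗ δ) δ X).symm ≪≫ whiskerRightIso (whiskerRightIso m δ ≪≫ λ_ δ) X ≪≫ f
    rw [← I.inv_hom_id, show I.hom = 0 from h0, comp_zero]
  have h4 : (c - 1) • ((α_ (δ ⊗ δ) δ X).inv ≫ (m.hom ▷ δ ≫ (λ_ δ).hom) ▷ X ≫ f.hom) = 0 := by
    rw [sub_smul, one_smul, sub_eq_zero]
    exact (smul_right_injective _ hs0 h2).symm
  exact sub_eq_zero.1 ((smul_eq_zero.1 h4).resolve_right h3)

end Grading.IsSign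

/-! ### The Grothendieck ring of a fusion category -/

section Grothendieck

section

variable {C : Type w'} [Category.{v'} C] [Abelian C] [MonoidalCategory C]

lemma K0.cls_congr {X Y : C} (e : X ≅ Y) : K0.cls X = K0.cls Y := by
  rw [K0.cls, K0.cls, congr_toSkeleton_of_iso e]

variable (C) in
lemma K0.cls_unit : K0.cls (𝟙_ C) = 1 := by
  rw [K0.cls, ← Skeleton.one_eq, map_one, map_one]
  rfl

lemma K0.cls_tensor (X Y : C) : K0.cls (X ⊗ Y) = K0.cls X * K0.cls Y := by
  rw [K0.cls, Skeleton.toSkeleton_tensorObj, map_mul, map_mul]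
  rfl

lemma K0.cls_shortExact {S : ShortComplex C} (hS : S.ShortExact) :
    K0.cls S.X₂ = K0.cls S.X₁ + K0.cls S.X₃ :=
  (RingQuot.mkRingHom_rel (K0Rel.mk S hS)).trans (map_add _ _ _)

lemma K0.cls_biprod (X Y : C) : K0.cls (X ⊞ Y) = K0.cls X + K0.cls Y :=
  K0.cls_shortExact (ShortComplex.Splitting.ofHasBinaryBiproduct X Y).shortExact

lemma K0.ringHom_ext {R : Type*} [Ring R] {φ ψ : K0 C →+* R}
    (h : ∀ X : C, φ (K0.cls X) = ψ (K0.cls X)) : φ = ψ := by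
  refine RingQuot.ringQuot_ext _ _ (MonoidAlgebra.ringHom_ext' (Subsingleton.elim _ _) ?_)
  refine MonoidHom.ext fun c => ?_
  have := h ((fromSkeleton C).obj c)
  simp only [K0.cls, toSkeleton_fromSkeleton_obj] at this
  exact this

/-- Existence of an additive and multiplicative function on objects as a ring homomorphism. -/
lemma exists_ringHom_cls (d : C → ℝ) (hiso : ∀ X Y, Nonempty (X ≅ Y) → d X = d Y)
    (hone : d (𝟙_ C) = 1) (hmul : ∀ X Y, d (X ⊗ Y) = d X * d Y)
    (hadd : ∀ X Y, d (X ⊞ Y) = d X + d Y)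
    (hsplit : ∀ S : ShortComplex C, S.ShortExact → Nonempty (S.X₂ ≅ S.X₁ ⊞ S.X₃)) :
    ∃ φ : K0 C →+* ℝ, ∀ X, φ (K0.cls X) = d X := by
  have hd : ∀ X, d ((fromSkeleton C).obj (toSkeleton X)) = d X := fun X =>
    hiso _ _ ⟨fromSkeletonToSkeletonIso X⟩
  let F : Skeleton C →* ℝ :=
    { toFun := fun c => d ((fromSkeleton C).obj c)
      map_one' := by rw [Skeleton.one_eq, hd, hone]
      map_mul' := fun a b => by
        rw [← toSkeleton_fromSkeleton_obj a, ← toSkeleton_fromSkeleton_obj b,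
          ← Skeleton.toSkeleton_tensorObj, hd, hd, hd, hmul] }
  let f : MonoidAlgebra ℤ (Skeleton C) →+* ℝ := (MonoidAlgebra.lift ℤ ℝ (Skeleton C) F).toRingHom
  have hf : ∀ X, f (MonoidAlgebra.of ℤ _ (toSkeleton X)) = d X := fun X =>
    (MonoidAlgebra.lift_of F _).trans (hd X)
  refine ⟨RingQuot.lift ⟨f, ?_⟩, fun X => (RingQuot.lift_mkRingHom_apply _ _ _).trans (hf X)⟩
  rintro _ _ ⟨S, hS⟩
  rw [map_add, hf, hf, hf, ← hadd]
  exact hiso _ _ (hsplit S hS)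

end

variable (k : Type u') [Field k] {C : Type w'} [Category.{v'} C] [Abelian C] [Linear k C]
  [MonoidalCategory C] [MonoidalPreadditive C] [MonoidalLinear k C] [RigidCategory C]
  [IsFusion k C]

/-- The sum of the multiplicities of the simple objects in an object, weighted by `w`. -/
noncomputable def weightedDim (w : C → ℝ) (X : C) : ℝ :=
  ∑ c ∈ (IsFusion.finite_simples k (C := C)).toFinset,
    homDim k ((fromSkeleton C).obj c) X * w ((fromSkeleton C).obj c)

variable {w : C → ℝ}

lemma weightedDim_congr {X Y : C} (e : X ≅ Y) : weightedDim k w X = weightedDim k w Y :=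
  Finset.sum_congr rfl fun c _ => by rw [homDim_congr k (Iso.refl _) e]

lemma weightedDim_biprod (X Y : C) :
    weightedDim k w (X ⊞ Y) = weightedDim k w X + weightedDim k w Y := by
  simp only [weightedDim, homDim_biprod_right, Nat.cast_add, add_mul, Finset.sum_add_distrib]

lemma weightedDim_biproduct {J : Type*} [Fintype J] (F : J → C) :
    weightedDim k w (⨁ F) = ∑ j, weightedDim k w (F j) := by
  simp only [weightedDim, homDim_biproduct_right, Nat.cast_sum, Finset.sum_mul]
  exact Finset.sum_comm

variable [IsAlgClosed k]

include k in
lemma K0.cls_biproduct : ∀ (n : ℕ) (S : Fin n → C), K0.cls (⨁ S) = ∑ i, K0.cls (S i)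
  | 0, S => by
    -- The empty sum is isomorphic to its own double, so its class is zero.
    obtain ⟨e⟩ : Nonempty (⨁ S ≅ (⨁ S) ⊞ (⨁ S)) := nonempty_iso_of_homDim_eq k fun U _ => by
      rw [homDim_biprod_right, homDim_biproduct_right]
      simp
    have h := K0.cls_congr e
    rw [K0.cls_biprod] at h
    simpa using h
  | n + 1, S => by
    obtain ⟨e⟩ : Nonempty (⨁ S ≅ S 0 ⊞ ⨁ fun i : Fin n => S i.succ) :=
      nonempty_iso_of_homDim_eq k fun U _ => by
        rw [homDim_biprod_right, homDim_biproduct_right, homDim_biproduct_right, Fin.sum_univ_succ]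
    rw [K0.cls_congr e, K0.cls_biprod, K0.cls_biproduct n, Fin.sum_univ_succ]

lemma weightedDim_simple (hw : ∀ X Y, Nonempty (X ≅ Y) → w X = w Y) (S : C) [hS : Simple S] :
    weightedDim k w S = w S := by
  have hmem : toSkeleton S ∈ (IsFusion.finite_simples k (C := C)).toFinset := by
    rw [Set.Finite.mem_toFinset]
    exact ⟨S, hS, rfl⟩
  have e := fromSkeletonToSkeletonIso S
  rw [weightedDim, Finset.sum_eq_single_of_mem _ hmem, homDim_congr k e (Iso.refl S),
    homDim_self_simple, hw _ _ ⟨e⟩, Nat.cast_one, one_mul]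
  intro c hc hne
  rw [Set.Finite.mem_toFinset] at hc
  obtain ⟨T, hT, rfl⟩ := hc
  have hT' : Simple T := hT
  rw [homDim_congr k (fromSkeletonToSkeletonIso T) (Iso.refl S), homDim_simple_of_isEmpty,
    Nat.cast_zero, zero_mul]
  exact ⟨fun f => hne (congr_toSkeleton_of_iso f)⟩

/-- Distributivity reduces multiplicativity to pairs of simple objects. -/
lemma weightedDim_tensor (hw : ∀ X Y, Nonempty (X ≅ Y) → w X = w Y)
    (h : ∀ S T : C, Simple S → Simple T → weightedDim k w (S ⊗ T) = w S * w T) (X Y : C) :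
    weightedDim k w (X ⊗ Y) = weightedDim k w X * weightedDim k w Y := by
  obtain ⟨n, S, hS, ⟨e⟩⟩ := exists_iso_biproduct_simple k X
  obtain ⟨m, T, hT, ⟨e'⟩⟩ := exists_iso_biproduct_simple k Y
  rw [weightedDim_congr k ((e ⊗ᵢ e') ≪≫ rightDistributor _ _), weightedDim_congr k e,
    weightedDim_congr k e', weightedDim_biproduct, weightedDim_biproduct, weightedDim_biproduct,
    Finset.sum_mul_sum]
  refine Finset.sum_congr rfl fun i _ => ?_
  rw [weightedDim_congr k (leftDistributor _ _), weightedDim_biproduct]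
  refine Finset.sum_congr rfl fun j _ => ?_
  have := hS i
  have := hT j
  rw [h _ _ (hS i) (hT j), weightedDim_simple k hw, weightedDim_simple k hw]

lemma one_le_weightedDim (hw : ∀ X Y, Nonempty (X ≅ Y) → w X = w Y) (h : ∀ X, 1 ≤ w X) {X : C}
    (hX : ¬ IsZero X) : 1 ≤ weightedDim k w X := by
  obtain ⟨n, S, hS, ⟨e⟩⟩ := exists_iso_biproduct_simple k X
  have hn : n ≠ 0 := by
    rintro rfl
    refine hX (isZero_of_homDim k fun U _ => ?_)
    rw [homDim_congr k (Iso.refl U) e, homDim_biproduct_right]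
    simp
  have hsum : weightedDim k w X = ∑ i, w (S i) := by
    rw [weightedDim_congr k e, weightedDim_biproduct]
    refine Finset.sum_congr rfl fun i _ => ?_
    have := hS i
    rw [weightedDim_simple k hw]
  rw [hsum]
  refine (h (S ⟨0, Nat.pos_of_ne_zero hn⟩)).trans
    (Finset.single_le_sum (f := fun i => w (S i)) (fun i _ => ?_) (Finset.mem_univ _))
  exact zero_le_one.trans (h _)

/-- A weight on simple objects, compatible with tensor products and which every candidate for the
Frobenius-Perron dimension must take, is the Frobenius-Perron dimension. -/
lemma FPdim_eq_of_weight (hw : ∀ X Y, Nonempty (X ≅ Y) → w X = w Y) (hw1 : ∀ X, 1 ≤ w X)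
    (hunit : w (𝟙_ C) = 1)
    (h : ∀ S T : C, Simple S → Simple T → weightedDim k w (S ⊗ T) = w S * w T)
    (huniq : ∀ φ : K0 C →+* ℝ, IsFPdim φ → ∀ S : C, Simple S → φ (K0.cls S) = w S)
    (S : C) [Simple S] : FPdim S = w S := by
  have := simple_tensorUnit k C
  obtain ⟨φ, hφ⟩ := exists_ringHom_cls (weightedDim k w)
    (fun X Y ⟨e⟩ => weightedDim_congr k e) (by rw [weightedDim_simple k hw, hunit])
    (weightedDim_tensor k hw h) (weightedDim_biprod k) fun S hS => iso_biprod_of_shortExact k hS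
  have hφ1 : IsFPdim φ := fun X hX => by
    rw [hφ]
    exact one_le_weightedDim k hw hw1 hX
  -- Classes of simple objects generate the Grothendieck ring additively, so the forced values on
  -- them determine the homomorphism. Uniqueness is needed to leave the default value 0 of `FPdim`.
  have hex : ∃! φ : K0 C →+* ℝ, IsFPdim φ := by
    refine ⟨φ, hφ1, fun ψ hψ => K0.ringHom_ext fun X => ?_⟩
    obtain ⟨n, S, hS, ⟨e⟩⟩ := exists_iso_biproduct_simple k X
    rw [K0.cls_congr e, K0.cls_biproduct k, map_sum, map_sum]
    exact Finset.sum_congr rfl fun i _ => by rw [huniq ψ hψ _ (hS i), huniq φ hφ1 _ (hS i)]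
  rw [FPdim, dif_pos hex]
  exact huniq _ hex.choose_spec.1 S inferInstance

end Grothendieck

/-! ### Frobenius–Perron dimensions of the simple objects -/

namespace Grading.IsSign

variable (k : Type u') [Field k] {C : Type w'} [Category.{v'} C] [Abelian C] [Linear k C]
  [MonoidalCategory C] [MonoidalPreadditive C] [MonoidalLinear k C] [RigidCategory C]
  [IsFusion k C] [IsAlgClosed k] {G : Type*} [Group G] [Finite G] {Γ : Grading C G} {δ : C}
  (hδ : Γ.IsSign δ)

open Classical in
/-- The Frobenius-Perron dimension of a simple object. -/
noncomputable def _root_.Fusion.simpleDim (δ X : C) : ℝ := if IsFixed δ X then √2 else 1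

include k hδ in
lemma FPdim_simple (S : C) [Simple S] : FPdim S = simpleDim δ S := by
  have hw : ∀ X Y : C, Nonempty (X ≅ Y) → simpleDim δ X = simpleDim δ Y := fun X Y ⟨e⟩ => by
    classical
    exact if_congr ⟨fun h => h.of_iso e, fun h => h.of_iso e.symm⟩ rfl rfl
  have hfix : ∀ {X : C}, IsFixed δ X → simpleDim δ X = √2 := fun h => if_pos h
  have hnfix : ∀ {X : C}, ¬ IsFixed δ X → simpleDim δ X = 1 := fun h => if_neg h
  refine FPdim_eq_of_weight k hw (fun X => ?_) (hnfix (hδ.not_isFixed_unit))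
    (fun X Y hX hY => ?_) (fun φ hφ X hX => ?_) S
  · by_cases h : IsFixed δ X
    · rw [hfix h]
      exact Real.one_le_sqrt.2 one_le_two
    · rw [hnfix h]
  · by_cases hXf : IsFixed δ X
    · by_cases hYf : IsFixed δ Y
      · obtain ⟨T, hT, ⟨e⟩⟩ := hδ.exists_iso_biproduct_of_isFixed k hXf hYf
        have h1 : ∀ i, weightedDim k (simpleDim δ) (T i) = 1 := fun i => by
          have := (hT i).1
          rw [weightedDim_simple k hw, hnfix (hT i).2]
        rw [weightedDim_congr k e, weightedDim_biproduct, hfix hXf, hfix hYf,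
          Real.mul_self_sqrt zero_le_two]
        simp [h1]
      · have := hδ.simple_tensor_of_not_isFixed_right k X hYf
        rw [weightedDim_simple k hw, hfix hXf, hnfix hYf, hfix (hXf.tensor_right Y), mul_one]
    · have := hδ.simple_tensor_of_not_isFixed_left k Y hXf
      rw [weightedDim_simple k hw, hnfix hXf, one_mul]
      by_cases hYf : IsFixed δ Y
      · rw [hfix hYf, hfix (hδ.isFixed_tensor_left k X hYf)]
      · rw [hnfix hYf, hnfix (hδ.not_isFixed_tensor k hXf hYf)]
  -- The values at `T` and its dual are at least 1 with product 1, so both are 1. A fixed object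
  -- then has square 2, since `X ⊗ X` is a sum of two simples that are not fixed.
  · have hnfix' : ∀ T : C, Simple T → ¬ IsFixed δ T → φ (K0.cls T) = 1 := fun T hT hTf => by
      obtain ⟨e⟩ := hδ.tensor_dual_of_not_isFixed k hTf
      have h1 : φ (K0.cls T) * φ (K0.cls Tᘁ) = 1 := by
        rw [← map_mul, ← K0.cls_tensor, K0.cls_congr e, K0.cls_unit, map_one]
      have h2 := hφ T (Simple.not_isZero T)
      have h3 := hφ Tᘁ fun h0 =>
        not_isZero_tensorUnit k ((isZero_tensor_right T h0).of_iso e.symm)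
      nlinarith
    by_cases hXf : IsFixed δ X
    · obtain ⟨T, hT, ⟨e⟩⟩ := hδ.exists_iso_biproduct_of_isFixed k hXf hXf
      have h1 : φ (K0.cls X) * φ (K0.cls X) = 2 := by
        rw [← map_mul, ← K0.cls_tensor, K0.cls_congr e, K0.cls_biproduct k, map_sum,
          Fin.sum_univ_two, hnfix' _ (hT 0).1 (hT 0).2, hnfix' _ (hT 1).1 (hT 1).2]
        norm_num
      have h2 := hφ X (Simple.not_isZero X)
      rw [hfix hXf, ← h1, Real.sqrt_mul_self (by linarith)]
    · rw [hnfix hXf, hnfix' X hX hXf]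

end Grading.IsSign

/-! ### Normalized 3-cocycles on the group of order two -/

section Cocycle

variable {k : Type*} [Field k] (ω : Cocycle3 (Multiplicative (ZMod 2)) k)

/-- A normalized 3-cocycle on a group of order two is determined by one value. -/
lemma Cocycle3.eq_trivial (h : ω.toFun (.ofAdd 1) (.ofAdd 1) (.ofAdd 1) = 1) :
    ω = Cocycle3.trivial _ k := by
  have h2 : ∀ g : Multiplicative (ZMod 2), g = 1 ∨ g = .ofAdd 1 := by decide
  have key : ω.toFun = fun _ _ _ => 1 := by
    funext a b c
    rcases h2 a with rfl | rfl
    · exact ω.one_left b c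
    rcases h2 b with rfl | rfl
    · exact ω.one_mid _ c
    rcases h2 c with rfl | rfl
    · exact ω.one_right _ _
    exact h
  cases ω
  simp only at key
  subst key
  rfl

lemma Cocycle3.isCoboundary_trivial (G : Type*) [Group G] :
    (Cocycle3.trivial G k).IsCoboundary :=
  ⟨fun _ _ => 1, fun _ _ _ => by simp [Cocycle3.trivial]⟩

end Cocycle

/-! ### Sums in fusion subcategories and duals of simple objects -/

section Subcategory

variable (k : Type u') [Field k] [IsAlgClosed k] {C : Type w'} [Category.{v'} C] [Abelian C]
  [Linear k C] [MonoidalCategory C] [MonoidalPreadditive C] [MonoidalLinear k C]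
  [RigidCategory C] [IsFusion k C]

lemma IsFusionSubcategory.of_iso {C : Type w'} [Category.{v'} C] [Abelian C]
    [MonoidalCategory C] [RigidCategory C] {P : ObjectProperty C}
    (hP : IsFusionSubcategory P) {X Y : C} (e : X ≅ Y) (hX : P X) : P Y :=
  hP.summand Y X e.inv e.hom e.inv_hom_id hX

include k in
lemma IsFusionSubcategory.biproduct {P : ObjectProperty C} (hP : IsFusionSubcategory P) :
    ∀ (n : ℕ) (S : Fin n → C), (∀ i, P (S i)) → P (⨁ S)
  | 0, S, _ => hP.zero _ <| isZero_of_homDim k fun U _ => by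
      rw [homDim_biproduct_right]
      simp
  | n + 1, S, hS => by
    obtain ⟨e⟩ : Nonempty (⨁ S ≅ S 0 ⊞ ⨁ fun i : Fin n => S i.succ) :=
      nonempty_iso_of_homDim_eq k fun U _ => by
        rw [homDim_biprod_right, homDim_biproduct_right, homDim_biproduct_right, Fin.sum_univ_succ]
    exact hP.of_iso e.symm (hP.biprod _ _ (hS 0) (hP.biproduct n _ fun i => hS i.succ))

-- The adjunction gives `dim End(Xᘁ) = dim Hom(𝟙_ C, X ⊗ Xᘁ) = 1`.
include k in
lemma simple_rightDual (X : C) [Simple X] : Simple Xᘁ := by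
  have h := homDim_unit_tensor_dual k X
  refine simple_of_homDim_self k (fun h0 => ?_) ?_
  · rw [homDim_of_isZero_right k _ (isZero_tensor_right X h0)] at h
    omega
  · rw [homDim_congr k (ρ_ Xᘁ).symm (Iso.refl Xᘁ), homDim_tensor_left_adj, h]

end Subcategory

/-! ### Relations in the universal grading group -/

section UniversalGrading

variable {C : Type w'} [Category.{v'} C] [Abelian C] [MonoidalCategory C]

lemma universalDegree_mul {X Y Z : C} [hX : Simple X] [hY : Simple Y] (h : IsConstituent Z (X ⊗ Y)) :
    universalDegree X hX * universalDegree Y hY = universalDegree Z h.1 := by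
  have h1 := PresentedGroup.one_of_mem (rels := gradingRels C)
    (show FreeGroup.of ⟨X, hX⟩ * FreeGroup.of ⟨Y, hY⟩ * (FreeGroup.of ⟨Z, h.1⟩)⁻¹ ∈ gradingRels C
      from ⟨⟨X, hX⟩, ⟨Y, hY⟩, ⟨Z, h.1⟩, h, rfl⟩)
  rw [map_mul, map_mul, map_inv, mul_inv_eq_one] at h1
  exact h1

omit [MonoidalCategory C] in
lemma isConstituent_of_iso {X Y : C} [hX : Simple X] (e : X ≅ Y) : IsConstituent X Y :=
  ⟨hX, e.hom, fun h => id_nonzero X (by rw [← e.hom_inv_id, h, zero_comp])⟩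

variable [hunit : Simple (𝟙_ C)]

/-- Both `𝟙_ C` and `X` are constituents of `𝟙_ C ⊗ 𝟙_ C`: the first makes the degree of the unit
idempotent, hence trivial, and the second gives `X` the same degree. -/
lemma universalDegree_of_iso_unit {X : C} [hX : Simple X] (e : X ≅ 𝟙_ C) :
    universalDegree X hX = 1 := by
  have h1 := universalDegree_mul (isConstituent_of_iso (λ_ (𝟙_ C)).symm)
  have h2 := universalDegree_mul (isConstituent_of_iso (e ≪≫ (λ_ (𝟙_ C)).symm))
  rw [← h2, h1]
  exact mul_eq_left.1 h1

end UniversalGrading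

/-! ### Degree homomorphism, universality and counting -/

namespace Grading

section Degree

variable {C : Type w'} [Category.{v'} C] [Abelian C] [MonoidalCategory C]
  {G : Type*} [Group G] [Finite G] (Γ : Grading C G)

/-- The degree of a simple object. -/
noncomputable def degree (X : C) [Simple X] : G := (Γ.exists_component X).choose

lemma component_degree (X : C) [Simple X] : Γ.component (Γ.degree X) X :=
  (Γ.exists_component X).choose_spec

lemma degree_eq {g : G} {X : C} [Simple X] (h : Γ.component g X) : Γ.degree X = g :=
  Γ.eq_of_component (Simple.not_isZero X) (Γ.component_degree X) h

/-- The homomorphism from the universal grading group which corresponds to a grading. -/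
noncomputable def degreeHom : UniversalGradingGroup C →* G :=
  PresentedGroup.toGroup (f := fun X : {X : C // Simple X} => have := X.2; Γ.degree X.1) <| by
    rintro _ ⟨X, Y, Z, ⟨hZ, f, hf⟩, rfl⟩
    have := X.2
    have := Y.2
    rw [map_mul, map_mul, map_inv, FreeGroup.lift_apply_of, FreeGroup.lift_apply_of,
      FreeGroup.lift_apply_of, mul_inv_eq_one]
    exact (Γ.eq_of_hom_ne_zero (Γ.component_degree Z.1)
      (Γ.tensor _ _ _ _ (Γ.component_degree X.1) (Γ.component_degree Y.1)) hf).symm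

lemma degreeHom_universalDegree (X : C) [hX : Simple X] :
    Γ.degreeHom (universalDegree X hX) = Γ.degree X :=
  PresentedGroup.toGroup.of _

end Degree

variable (k : Type u') [Field k] {C : Type w'} [Category.{v'} C] [Abelian C] [Linear k C]
  [MonoidalCategory C] [MonoidalPreadditive C] [MonoidalLinear k C] [RigidCategory C]
  [IsFusion k C] {G : Type*} [Group G] [Finite G] {Γ : Grading C G} {δ : C}

include k in
lemma Faithful.exists_simple (hΓ : Γ.Faithful) (g : G) : ∃ X : C, Simple X ∧ Γ.component g X := by
  obtain ⟨X, hX, hX0⟩ := hΓ g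
  obtain ⟨S, hS, f, hf⟩ := exists_simple_hom_ne_zero k hX0
  obtain ⟨h, hh⟩ := Γ.exists_component S
  exact ⟨S, hS, Γ.eq_of_hom_ne_zero hh hX hf ▸ hh⟩

variable [IsAlgClosed k]

include k in
/-- Every element of the universal grading group is the degree of a simple object. -/
lemma _root_.Fusion.exists_universalDegree_eq (u : UniversalGradingGroup C) :
    ∃ (X : C) (hX : Simple X), universalDegree X hX = u := by
  have hunit := simple_tensorUnit k C
  have hmem : u ∈ Subgroup.closure (Set.range (PresentedGroup.of (rels := gradingRels C))) := by
    rw [PresentedGroup.closure_range_of]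
    exact Subgroup.mem_top _
  induction hmem using Subgroup.closure_induction with
  | mem u hu =>
    obtain ⟨X, rfl⟩ := hu
    exact ⟨X.1, X.2, rfl⟩
  | one => exact ⟨𝟙_ C, hunit, universalDegree_of_iso_unit (Iso.refl _)⟩
  | mul _ _ _ _ h₁ h₂ =>
    obtain ⟨X, hX, rfl⟩ := h₁
    obtain ⟨Y, hY, rfl⟩ := h₂
    -- Degrees of simples are closed under products because a nonzero tensor product has a simple
    -- constituent, and under inverses because the unit occurs in `X ⊗ Xᘁ`.
    obtain ⟨Z, hZ, f, hf⟩ := exists_simple_hom_ne_zero k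
      (not_isZero_tensor k (Simple.not_isZero X) (Simple.not_isZero Y))
    exact ⟨Z, hZ, (universalDegree_mul ⟨hZ, f, hf⟩).symm⟩
  | inv _ _ h =>
    obtain ⟨X, hX, rfl⟩ := h
    have hX' := simple_rightDual k X
    have h1 := homDim_unit_tensor_dual k X
    obtain ⟨f, hf⟩ := exists_ne_zero_of_homDim k (h1.trans_ne one_ne_zero)
    have h2 := universalDegree_mul ⟨hunit, f, hf⟩
    rw [universalDegree_of_iso_unit (Iso.refl _)] at h2
    exact ⟨Xᘁ, hX', eq_inv_of_mul_eq_one_right h2⟩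

include k in
lemma _root_.Fusion.IsFixed.isConstituent {X Y : C} [Simple X] [Simple Y] (hX : IsFixed δ X)
    (e : δ ≅ Y) :
    IsConstituent Y (X ⊗ Xᘁ) := by
  refine ⟨inferInstance, exists_ne_zero_of_homDim k ?_⟩
  rw [homDim_congr k e.symm (Iso.refl _), ← homDim_tensor_right_adj,
    homDim_congr k hX.some (Iso.refl X), homDim_self_simple]
  exact one_ne_zero

namespace IsSign

variable (hδ : Γ.IsSign δ)

include k hδ

/-- The trivial component is a fusion subcategory containing every `X ⊗ Xᘁ`, which gives one
inclusion. For the other, its objects are sums of copies of the unit and `δ`, and `δ` is a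
constituent of `X ⊗ Xᘁ` for the fixed `X`. -/
lemma component_one_eq_adjoint {X : C} [Simple X] (hX : IsFixed δ X) :
    Γ.component 1 = adjoint C := by
  have := hδ.simple
  funext Z
  refine propext ⟨fun hZ P hP hgen => ?_, fun hZ => hZ _ Γ.isFusionSubcategory_component_one ?_⟩
  · obtain ⟨n, S, hS, ⟨e⟩⟩ := exists_iso_biproduct_simple k Z
    refine hP.of_iso e.symm (hP.biproduct k n S fun i => ?_)
    have := hS i
    rcases hδ.iso_of_component_one k (Γ.component_of_iso_biproduct hZ e i) with ⟨⟨f⟩⟩ | ⟨⟨f⟩⟩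
    · exact hP.of_iso f hP.unit
    · exact hgen _ ⟨X, inferInstance, hX.isConstituent k f⟩
  · rintro Y ⟨X, hX, hY, f, hf⟩
    exact Γ.eq_of_hom_ne_zero (Γ.component_degree Y) (Γ.component_tensor_dual X) hf ▸
      Γ.component_degree Y

/-- If some simple object absorbs `δ`, the grading is universal. -/
lemma isUniversal (hΓ : Γ.Faithful) {X : C} [Simple X] (hX : IsFixed δ X) : Γ.IsUniversal := by
  have hunit := simple_tensorUnit k C
  refine ⟨hδ.component_one_eq_adjoint k hX, MulEquiv.ofBijective Γ.degreeHom ⟨?_, fun g => ?_⟩,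
    fun g Y hY hg => (Γ.degreeHom_universalDegree Y).trans (Γ.degree_eq hg)⟩
  · refine (injective_iff_map_eq_one _).2 fun u hu => ?_
    obtain ⟨Y, hY, rfl⟩ := exists_universalDegree_eq k u
    rw [Γ.degreeHom_universalDegree] at hu
    have hY1 := Γ.component_degree Y
    rw [hu] at hY1
    rcases hδ.iso_of_component_one k hY1 with ⟨⟨e⟩⟩ | ⟨⟨e⟩⟩
    · exact universalDegree_of_iso_unit e.symm
    -- For fixed `X`, both `δ` and the unit occur in `X ⊗ Xᘁ`, so they have the same universal
    -- degree.
    · have hX' := simple_rightDual k X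
      obtain ⟨f, hf⟩ := exists_ne_zero_of_homDim k
        ((homDim_unit_tensor_dual k X).trans_ne one_ne_zero)
      rw [← universalDegree_mul (hX.isConstituent k e),
        universalDegree_mul ⟨hunit, f, hf⟩, universalDegree_of_iso_unit (Iso.refl _)]
  · obtain ⟨Y, hY, hg⟩ := hΓ.exists_simple k g
    exact ⟨universalDegree Y hY, (Γ.degreeHom_universalDegree Y).trans (Γ.degree_eq hg)⟩

/-- The numbers of simple objects which do and do not absorb `δ`. -/
lemma ncard_isoClasses (hΓ : Γ.Faithful) {X₀ : C} [Simple X₀] (hX₀ : IsFixed δ X₀) :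
    ∃ n : ℕ, 1 ≤ n ∧ (isoClasses fun X : C => Simple X ∧ ¬ IsFixed δ X).ncard = 2 * n ∧
      (isoClasses fun X : C => Simple X ∧ IsFixed δ X).ncard = n ∧ Nat.card G = 2 * n := by
  choose P hPs hP using hΓ.exists_simple k
  -- Being fixed depends only on the degree, so `N` does not depend on the representatives `P g`.
  let N : Set G := {g | IsFixed δ (P g)}
  have hN : ∀ {g : G} {X : C} [Simple X], Γ.component g X → (g ∈ N ↔ IsFixed δ X) :=
    fun {g X} _ hX =>
      have := hPs g
      ⟨hδ.isFixed_of_component k (hP g) hX, hδ.isFixed_of_component k hX (hP g)⟩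
  have hPinj : Function.Injective fun g => toSkeleton (P g) := fun g h hgh => by
    have := hPs g
    obtain ⟨e⟩ := toSkeleton_eq_toSkeleton_iff.1 hgh
    exact Γ.eq_of_component (Simple.not_isZero (P g)) (hP g) (Γ.of_iso h _ _ e.symm (hP h))
  have hδPinj : Function.Injective fun g => toSkeleton (δ ⊗ P g) := fun g h hgh => by
    have := hPs g
    have := hδ.simple_tensor k (P g)
    obtain ⟨e⟩ := toSkeleton_eq_toSkeleton_iff.1 hgh
    exact Γ.eq_of_component (Simple.not_isZero (δ ⊗ P g)) (hδ.component_tensor (hP g))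
      (Γ.of_iso h _ _ e.symm (hδ.component_tensor (hP h)))
  have hfixed : (isoClasses fun X : C => Simple X ∧ IsFixed δ X) =
      (fun g => toSkeleton (P g)) '' N := by
    ext c
    constructor
    · rintro ⟨X, ⟨hX, hXf⟩, rfl⟩
      obtain ⟨g, hg⟩ := Γ.exists_component X
      have := hPs g
      obtain ⟨e⟩ := hδ.iso_of_isFixed k hg (hP g) hXf
      exact ⟨g, (hN hg).2 hXf, congr_toSkeleton_of_iso e.symm⟩
    · rintro ⟨g, hg, rfl⟩
      exact ⟨P g, ⟨hPs g, hg⟩, rfl⟩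
  -- A degree outside `N` contributes the two classes `P g` and `δ ⊗ P g`, a degree in `N` just one.
  have hfree : (isoClasses fun X : C => Simple X ∧ ¬ IsFixed δ X) =
      (fun g => toSkeleton (P g)) '' Nᶜ ∪ (fun g => toSkeleton (δ ⊗ P g)) '' Nᶜ := by
    ext c
    constructor
    · rintro ⟨X, ⟨hX, hXf⟩, rfl⟩
      obtain ⟨g, hg⟩ := Γ.exists_component X
      have := hPs g
      have hgN : g ∈ Nᶜ := fun h => hXf ((hN hg).1 h)
      rcases hδ.iso_of_component k (hP g) hg with ⟨⟨e⟩⟩ | ⟨⟨e⟩⟩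
      · exact Or.inl ⟨g, hgN, congr_toSkeleton_of_iso e⟩
      · exact Or.inr ⟨g, hgN, congr_toSkeleton_of_iso e⟩
    · rintro (⟨g, hg, rfl⟩ | ⟨g, hg, rfl⟩)
      · exact ⟨P g, ⟨hPs g, hg⟩, rfl⟩
      · have := hPs g
        have := hδ.simple_tensor k (P g)
        exact ⟨δ ⊗ P g, ⟨this, fun h => hg ((hN (hδ.component_tensor (hP g))).2 h)⟩, rfl⟩
  have hdisj : Disjoint ((fun g => toSkeleton (P g)) '' Nᶜ)
      ((fun g => toSkeleton (δ ⊗ P g)) '' Nᶜ) := by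
    rw [Set.disjoint_left]
    rintro _ ⟨g, hg, rfl⟩ ⟨h, hh, e⟩
    have := hPs g
    obtain ⟨e⟩ := toSkeleton_eq_toSkeleton_iff.1 e
    have hgh := Γ.eq_of_component (Simple.not_isZero (P g)) (hP g)
      (Γ.of_iso h _ _ e (hδ.component_tensor (hP h)))
    subst hgh
    exact hg ⟨e⟩
  obtain ⟨g₀, hg₀⟩ := Γ.exists_component X₀
  -- Right translation by `g₀ ∈ N` sends `N` into its complement, since fixed times fixed has no
  -- fixed summand; it sends the complement into `N`, since a product with the fixed `X₀` is fixed.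
  have hle : N.ncard ≤ Nᶜ.ncard := by
    rw [← Set.ncard_image_of_injective N (mul_left_injective g₀)]
    refine Set.ncard_le_ncard ?_ (Set.toFinite _)
    rintro _ ⟨g, hg, rfl⟩ hgg
    have := hPs g
    obtain ⟨S, hS, ⟨e⟩⟩ := hδ.exists_iso_biproduct_of_isFixed k hg hX₀
    have := (hS 0).1
    exact (hS 0).2 ((hN (Γ.component_of_iso_biproduct (Γ.tensor _ _ _ _ (hP g) hg₀) e 0)).1 hgg)
  have hge : Nᶜ.ncard ≤ N.ncard := by
    rw [← Set.ncard_image_of_injective Nᶜ (mul_left_injective g₀)]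
    refine Set.ncard_le_ncard ?_ (Set.toFinite _)
    rintro _ ⟨g, hg, rfl⟩
    have := hPs g
    have := hδ.simple_tensor_of_not_isFixed_left k X₀ hg
    exact (hN (Γ.tensor _ _ _ _ (hP g) hg₀)).2 (hδ.isFixed_tensor_left k (P g) hX₀)
  have heq := le_antisymm hle hge
  refine ⟨N.ncard, ?_, ?_, ?_, ?_⟩
  · exact (Set.ncard_pos (Set.toFinite _)).2 ⟨g₀, (hN hg₀).2 hX₀⟩
  · rw [hfree, Set.ncard_union_eq hdisj ((Set.toFinite _).image _) ((Set.toFinite _).image _),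
      Set.ncard_image_of_injective _ hPinj, Set.ncard_image_of_injective _ hδPinj]
    omega
  · rw [hfixed, Set.ncard_image_of_injective _ hPinj]
  · rw [← Set.ncard_add_ncard_compl N]
    omega

lemma FPdim_eq_sqrt_two_iff (X : C) [Simple X] : FPdim X = √2 ↔ IsFixed δ X := by
  rw [hδ.FPdim_simple k, simpleDim]
  split_ifs with h
  · simp [h]
  · simp only [h, iff_false]
    intro h1
    have h2 := Real.sq_sqrt (zero_le_two (α := ℝ))
    rw [← h1] at h2
    norm_num at h2

end IsSign

end Grading

end Fusion

/-! ### The classification theorem -/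

open Fusion

theorem theorem3p1 {k : Type*} [Field k] [IsAlgClosed k] [CharZero k]
    {C : Type*} [Category* C] [Abelian C] [Linear k C] [MonoidalCategory C]
    [MonoidalPreadditive C] [MonoidalLinear k C] [RigidCategory C] [Fusion.IsFusion k C]
    {G : Type*} [Group G] [Finite G] (Γ : Fusion.Grading C G) (hΓ : Γ.Faithful)
    (ω : Fusion.Cocycle3 (Multiplicative (ZMod 2)) k)
    (hω : Fusion.TensorEquivalent k (Γ.component 1).FullSubcategory (Fusion.VecG k ω)) :
    (¬ ω.IsCoboundary → Fusion.IsPointed C) ∧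
    (ω.IsCoboundary →
      (Fusion.IsPointed C ∨ Fusion.IsGeneralizedTY C) ∧
      (Fusion.IsGeneralizedTY C → ∃ n : ℕ, 1 ≤ n ∧
        (Fusion.isoClasses (fun X : C => Fusion.IsInvertible X)).ncard = 2 * n ∧
        (Fusion.isoClasses (fun X : C => Simple X ∧ Fusion.FPdim X = √2)).ncard = n ∧
        (∀ X : C, Simple X → Fusion.IsInvertible X ∨ Fusion.FPdim X = √2) ∧
        Fusion.TensorEquivalent k (Fusion.adjoint C).FullSubcategory
          (Fusion.VecG k (Fusion.Cocycle3.trivial (Multiplicative (ZMod 2)) k)) ∧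
        Γ.IsUniversal ∧
        Nat.card G = 2 * n)) := by
  obtain ⟨δ, hδ, m, hm⟩ := Γ.exists_isSign hω
  have hfix : ∀ X : C, Simple X → (¬ IsInvertible X ↔ IsFixed δ X) := fun X hX => by
    rw [hδ.isInvertible_iff k, not_not]
  have hexists : ¬ IsPointed C → ∃ X : C, Simple X ∧ IsFixed δ X := fun h => by
    unfold IsPointed at h
    push Not at h
    obtain ⟨X, hX, hX'⟩ := h
    exact ⟨X, hX, (hfix X hX).1 hX'⟩
  -- This is an equality of cocycles, not just of classes, so the given equivalence already has the
  -- untwisted category as its target.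
  have htriv : ¬ IsPointed C → ω = Cocycle3.trivial _ k := fun h => by
    obtain ⟨X, hX, hXf⟩ := hexists h
    exact ω.eq_trivial (Units.ext (hXf.pairing_scalar_eq_one k m hm))
  refine ⟨fun h => ?_, fun _ => ⟨?_, fun hTY => ?_⟩⟩
  · by_contra hp
    exact h (htriv hp ▸ Cocycle3.isCoboundary_trivial _)
  · refine or_iff_not_imp_left.2 fun hp => ⟨hp, fun X Y hX hY hXi hYi => ?_⟩
    obtain ⟨S, hS, e⟩ :=
      hδ.exists_iso_biproduct_of_isFixed k ((hfix X hX).1 hXi) ((hfix Y hY).1 hYi)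
    refine ⟨2, S, fun i => ?_, e⟩
    have := (hS i).1
    exact (hδ.isInvertible_iff k _).2 (hS i).2
  · obtain ⟨X, hX, hXf⟩ := hexists hTY.1
    obtain ⟨n, hn, hfree, hfixed, hG⟩ := hδ.ncard_isoClasses k hΓ hXf
    have hinv : (fun X : C => IsInvertible X) = fun X => Simple X ∧ ¬ IsFixed δ X := by
      funext X
      refine propext ⟨fun h => ?_, fun ⟨_, h⟩ => (hδ.isInvertible_iff k X).2 h⟩
      have := h.1
      exact ⟨this, (hδ.isInvertible_iff k X).1 h⟩
    have hdim : (fun X : C => Simple X ∧ FPdim X = √2) = fun X => Simple X ∧ IsFixed δ X := by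
      funext X
      exact propext (and_congr_right fun _ => hδ.FPdim_eq_sqrt_two_iff k X)
    refine ⟨n, hn, ?_, ?_, fun Y hY => ?_, ?_, hδ.isUniversal k hΓ hXf, hG⟩
    · rw [hinv, hfree]
    · rw [hdim, hfixed]
    · rw [hδ.isInvertible_iff k, hδ.FPdim_eq_sqrt_two_iff k]
      exact (em _).symm
    -- Generalizing over `P` lets the equality with the adjoint subcategory be substituted inside
    -- the type of the full subcategory.
    · have htransfer : ∀ (P : ObjectProperty C) [P.IsMonoidal], Γ.component 1 = P →
          TensorEquivalent k P.FullSubcategory (VecG k ω) := by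
        rintro P _ rfl
        exact hω
      rw [← htriv hTY.1]
      exact htransfer _ (hδ.component_one_eq_adjoint k hXf)
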